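/- Let $R$ be a commutative ring, $H$ an $R$-bialgebra, $A$ a right $H$-comodule algebra with coaction $a\mapsto\sum a_{<0>}\otimes a_{<1>}$, and $C$ an $R$-coalgebra. If $C$ is a right $H$-module coalgebra, $(H,A,C)$ is called a right-right Doi-Koppinen structure, and $\mathcal M(H)_A^C$ is the category of right $A$-modules $M$ that are also (counital) right $C$-comodules with $\varrho(ma)=\sum m_{<0>}a_{<0>}\otimes m_{<1>}a_{<1>}$; if $C$ is a left $H$-module coalgebra, $(H,A,C)$ is called a left-right Doi-Koppinen structure, and ${}_A\mathcal M(H)^C$ is the category of left $A$-modules $M$ that are also right $C$-comodules with $\varrho(am)=\sum a_{<0>}m_{<0>}\otimes a_{<1>}m_{<1>}$. Morphisms are the $A$-linear $C$-colinear maps. In the left-right case $(H^{op},A^{op},C)$ is a right-right structure. Let $C^*=\mathrm{Hom}_R(C,R)$ with $(f\star g)(c)=\sum f(c_1)g(c_2)$, and let $C^\Box=\mathrm{Rat}^C({}_{C^*}C^*)$ be the set of $g\in C^*$ for which there is $\sum g_i\otimes c_i\in C^*\otimes_R C$ with $f\star g=\sum f(c_i)g_i$ for all $f\in C^*$. Assume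 that ${}_RC$ is locally projective, that $C$ is left coproper (for all $f\in C^*$ and finite $F\subseteq C$ some $g\in C^\Box$ agrees with $f$ on $F$), and that $C^\Box\subseteq C^*$ is $A$-pure ($A\otimes_RC^\Box\to A\otimes_RC^*$ is injective). For a right-right structure, let $A\#^{op}C^\Box=A\otimes_RC^\Box$ be the (in general non-unital) $R$-algebra with product $(a\#f)(b\#g)=\sum a_{<0>}b\#(a_{<1>}g)\star f$, where $(hg)(c)=g(ch)$. Let $\mathcal C=A\otimes_RC$ be the $A$-coring with $b(a\otimes c)=ba\otimes c$, $(b\otimes c)a=\sum ba_{<0>}\otimes ca_{<1>}$, $\Delta(a\otimes c)=\sum(a\otimes c_1)\otimes_A(1\otimes c_2)$ and $\varepsilon(a\otimes c)=a\,\varepsilon_C(c)$, let ${}^*\mathcal C=\mathrm{Hom}_{A-}(\mathcal C,A)$ with product $(f\star g)(d)=\sum g(d_1f(d_2))$, and let ${}^\Box\mathcal C=\mathrm{Rat}^{\mathcal C}({}^*\mathcal C_{{}^*\mathcal C})$ be the set of $f\in{}^*\mathcal C$ for which there is $\sum f_i\otimes d_i\in{}^*\mathcal C\otimes_A\mathcal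 C$ with $f\star g=\sum f_i\,g(d_i)$ for all $g\in{}^*\mathcal C$. In the left-right case let $A\#C^\Box=(A^{op}\#^{op}C^\Box)^{op}$, and let $\mathcal D=A^{op}\otimes_RC$ be the $A^{op}$-coring of $(H^{op},A^{op},C)$. For a possibly non-unital $R$-algebra $T$, write $\mathcal M_T$ (resp. ${}_T\mathcal M$) for the category of right (resp. left) $T$-modules $M$ with $MT=M$ (resp. $TM=M$), that is, $R$-modules with an associative $R$-bilinear action of $T$. Then, for every right-right Doi-Koppinen structure as above, $$\mathcal M(H)_A^C=\mathcal M_{A\#^{op}C^\Box}=\mathcal M_{{}^\Box\mathcal C},$$ i.e. each $M\in\mathcal M(H)_A^C$ is a unital module via $m(a\#f)=\sum f(m_{<1>})\,m_{<0>}a$, resp. $mf=\sum m_{<0>}f(1\otimes m_{<1>})$, and these assignments (identity on underlying $R$-modules and maps) are isomorphisms of categories. For every left-right Doi-Koppinen structure as above, $${}_A\mathcal M(H)^C\simeq{}_{A\#C^\Box}\mathcal M\simeq{}_{({}^\Box\mathcal D)^{op}}\mathcal M$$ are isomorphisms of categories, via $(a\#f)m=\sum f(m_{<1>})\,a\,m_{<0>}$,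 resp. $fm=\sum f(1\otimes m_{<1>})\,m_{<0>}$. -/

import Mathlib

open scoped TensorProduct

universe u₁ u₂ u₃ u₄ w

namespace DoiKoppinen

open TensorProduct CategoryTheory

noncomputable section

/-! ### Locally projective modules, rational submodules, density -/

/-- A module `W` is locally projective (Zimmermann-Huisgen) if for every finitely generated
submodule `F` of `W`, every surjection `π : L → N` and every `g : W → N` there is `g' : W → L`
such that `π ∘ g'` and `g` agree on `F`. -/
def IsLocallyProjective (R : Type u₁) (W : Type u₂) [CommRing R] [AddCommGroup W] [Module R W] :
    Prop :=
  ∀ (F : Submodule R W), F.FG →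
    ∀ (L N : Type (max u₁ u₂)) [AddCommGroup L] [AddCommGroup N] [Module R L] [Module R N]
      (π : L →ₗ[R] N), Function.Surjective π →
      ∀ g : W →ₗ[R] N, ∃ g' : W →ₗ[R] L, ∀ x ∈ F, π (g' x) = g x

section Coalgebra

variable (R : Type u₁) (C : Type u₄) [CommRing R] [AddCommGroup C] [Module R C] [Coalgebra R C]

/-- The dual algebra `C* = Hom_R(C, R)` with the convolution product
`(f ⋆ g)(c) = ∑ f(c₁) g(c₂)` and unit the counit. -/
abbrev Dual : Type (max u₁ u₄) := WithConv (C →ₗ[R] R)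

variable {R C}

/-- `∑ fᵢ ⊗ cᵢ ↦ ∑ f(cᵢ) fᵢ`. -/
def dualEval (f : Dual R C) : Dual R C ⊗[R] C →ₗ[R] Dual R C :=
  TensorProduct.lift (LinearMap.mk₂ R (fun (g : Dual R C) (c : C) => (f c) • g)
    (fun _ _ _ => smul_add _ _ _) (fun r g c => smul_comm _ _ _)
    (fun g c d => by
      change f.ofConv (c + d) • g = f.ofConv c • g + f.ofConv d • g
      rw [map_add, add_smul])
    (fun r g c => by
      change f.ofConv (r • c) • g = r • f.ofConv c • g
      rw [map_smul, smul_assoc]))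

variable (R C)

/-- `C^□`, the rational part of `C*` regarded as a left `C*`-module: those `g` for which there is
`∑ gᵢ ⊗ cᵢ ∈ C* ⊗ C` with `f ⋆ g = ∑ f(cᵢ) gᵢ` for all `f ∈ C*`. -/
def boxDual : Submodule R (Dual R C) where
  carrier := {g | ∃ t : Dual R C ⊗[R] C, ∀ f : Dual R C, f * g = dualEval f t}
  add_mem' := by
    rintro a b ⟨s, hs⟩ ⟨t, ht⟩
    exact ⟨s + t, fun f => by rw [mul_add, hs, ht, map_add]⟩
  zero_mem' := ⟨0, fun f => by rw [mul_zero, map_zero]⟩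
  smul_mem' := by
    rintro r a ⟨s, hs⟩
    exact ⟨r • s, fun f => by rw [mul_smul_comm, hs, map_smul]⟩

/-- `C` is left coproper: `C^□` is dense in `C*` for the finite topology. -/
def IsLeftCoproper : Prop :=
  ∀ (f : Dual R C) (F : Finset C), ∃ g ∈ boxDual R C, ∀ c ∈ F, g c = f c

/-- `C^□ ⊆ C*` is `A`-pure: `A ⊗ C^□ → A ⊗ C*` is injective. -/
def IsBoxPure (A : Type u₃) [Ring A] [Algebra R A] : Prop :=
  Function.Injective (LinearMap.lTensor A (boxDual R C).subtype)

end Coalgebra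

/-! ### The opposite bialgebra -/

section Op

/-- `x ⊗ y ↦ op x ⊗ op y`. -/
def opMap (R : Type u₁) (A : Type u₃) (H : Type u₂) [CommRing R] [Ring A] [Algebra R A] [Ring H]
    [Algebra R H] : A ⊗[R] H →ₗ[R] Aᵐᵒᵖ ⊗[R] Hᵐᵒᵖ :=
  TensorProduct.map (MulOpposite.opLinearEquiv R).toLinearMap
    (MulOpposite.opLinearEquiv R).toLinearMap

@[simp] lemma opMap_tmul {R : Type u₁} {A : Type u₃} {H : Type u₂} [CommRing R] [Ring A]
    [Algebra R A] [Ring H] [Algebra R H] (a : A) (h : H) :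
    opMap R A H (a ⊗ₜ h) = MulOpposite.op a ⊗ₜ MulOpposite.op h := rfl

lemma opMap_mul {R : Type u₁} {A : Type u₃} {H : Type u₂} [CommRing R] [Ring A]
    [Algebra R A] [Ring H] [Algebra R H] (x y : A ⊗[R] H) :
    opMap R A H (x * y) = opMap R A H y * opMap R A H x := by
  induction x with
  | zero => simp
  | add x x' hx hx' => rw [add_mul, map_add, hx, hx', map_add, mul_add]
  | tmul a h =>
    induction y with
    | zero => simp
    | add y y' hy hy' => rw [mul_add, map_add, hy, hy', map_add, add_mul]
    | tmul b k => simp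

variable {R : Type u₁} {H : Type u₂} [CommRing R] [Ring H] [Bialgebra R H]

lemma comul_op (h : H) : Coalgebra.comul (R := R) (MulOpposite.op h) =
    opMap R H H (Coalgebra.comul h) := rfl

lemma counit_op (h : H) : Coalgebra.counit (R := R) (MulOpposite.op h) =
    Coalgebra.counit (R := R) h := rfl

/-- The opposite bialgebra: opposite multiplication, same comultiplication. -/
instance opBialgebra : Bialgebra R Hᵐᵒᵖ :=
  Bialgebra.mk' R Hᵐᵒᵖ
    (by change Coalgebra.counit (R := R) (1 : H) = 1; exact Bialgebra.counit_one)
    (fun {a b} => by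
      change Coalgebra.counit (R := R) (b.unop * a.unop) =
        Coalgebra.counit (R := R) a.unop * Coalgebra.counit (R := R) b.unop
      rw [Bialgebra.counit_mul, mul_comm])
    (by
      change opMap R H H (Coalgebra.comul (1 : H)) = 1
      rw [Bialgebra.comul_one]; rfl)
    (fun {a b} => by
      change opMap R H H (Coalgebra.comul (b.unop * a.unop)) =
        opMap R H H (Coalgebra.comul a.unop) * opMap R H H (Coalgebra.comul b.unop)
      rw [Bialgebra.comul_mul, opMap_mul])

end Op

/-! ### Doi-Koppinen structures -/

section Structures

variable (R : Type u₁) (H : Type u₂) (A : Type u₃) (C : Type u₄) [CommRing R]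
  [Ring H] [Bialgebra R H] [Ring A] [Algebra R A] [AddCommGroup C] [Module R C] [Coalgebra R C]

/-- A right `H`-comodule algebra structure on `A`. -/
structure RightComoduleAlgebra where
  /-- the coaction `a ↦ ∑ a₀ ⊗ a₁`, an algebra morphism -/
  coact : A →ₐ[R] A ⊗[R] H
  coassoc : ∀ a, TensorProduct.assoc R A H H (LinearMap.rTensor H coact.toLinearMap (coact a)) =
    LinearMap.lTensor A Coalgebra.comul (coact a)
  counit : ∀ a, LinearMap.lTensor A Coalgebra.counit (coact a) = a ⊗ₜ[R] (1 : R)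

/-- A right `H`-module coalgebra structure on `C`. -/
structure RightModuleCoalgebra where
  /-- the right action `(c, h) ↦ c h` -/
  act : C →ₗ[R] H →ₗ[R] C
  act_one : ∀ c, act c 1 = c
  act_mul : ∀ c h k, act c (h * k) = act (act c h) k
  comul_act : ∀ c h, Coalgebra.comul (R := R) (act c h) =
    TensorProduct.map₂ act act (Coalgebra.comul c) (Coalgebra.comul h)
  counit_act : ∀ c h, Coalgebra.counit (R := R) (act c h) =
    Coalgebra.counit c * Coalgebra.counit h

/-- A left `H`-module coalgebra structure on `C`. -/
structure LeftModuleCoalgebra where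
  /-- the left action `(h, c) ↦ h c` -/
  act : H →ₗ[R] C →ₗ[R] C
  one_act : ∀ c, act 1 c = c
  mul_act : ∀ h k c, act (h * k) c = act h (act k c)
  comul_act : ∀ h c, Coalgebra.comul (R := R) (act h c) =
    TensorProduct.map₂ act act (Coalgebra.comul h) (Coalgebra.comul c)
  counit_act : ∀ h c, Coalgebra.counit (R := R) (act h c) =
    Coalgebra.counit h * Coalgebra.counit c

/-- A right-right Doi-Koppinen structure `(H, A, C)`. -/
structure RightRight where
  alg : RightComoduleAlgebra R H A
  coalg : RightModuleCoalgebra R H C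

/-- A left-right Doi-Koppinen structure `(H, A, C)`. -/
structure LeftRight where
  alg : RightComoduleAlgebra R H A
  coalg : LeftModuleCoalgebra R H C

end Structures

section OpStructure

variable {R : Type u₁} {H : Type u₂} {A : Type u₃} {C : Type u₄} [CommRing R]
  [Ring H] [Bialgebra R H] [Ring A] [Algebra R A] [AddCommGroup C] [Module R C] [Coalgebra R C]

/-- `Aᵒᵖ` is a right `Hᵒᵖ`-comodule algebra, with the same coaction as `A`. -/
def RightComoduleAlgebra.op (S : RightComoduleAlgebra R H A) :
    RightComoduleAlgebra R Hᵐᵒᵖ Aᵐᵒᵖ where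
  coact := AlgHom.ofLinearMap
    (opMap R A H ∘ₗ S.coact.toLinearMap ∘ₗ (MulOpposite.opLinearEquiv R).symm.toLinearMap)
    (by simp; rfl)
    (fun x y => by simp [opMap_mul])
  coassoc a := by
    have h := congrArg (TensorProduct.map (MulOpposite.opLinearEquiv R (M := A)).toLinearMap
      (opMap R H H)) (S.coassoc a.unop)
    unfold opMap at h
    rw [TensorProduct.map_map_assoc, LinearMap.map_rTensor, LinearMap.map_lTensor] at h
    change TensorProduct.assoc R Aᵐᵒᵖ Hᵐᵒᵖ Hᵐᵒᵖ (LinearMap.rTensor _ _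
      (opMap R A H (S.coact a.unop))) = LinearMap.lTensor _ _ (opMap R A H (S.coact a.unop))
    unfold opMap
    rw [LinearMap.rTensor_map, LinearMap.lTensor_map]
    exact h
  counit a := by
    have h := congrArg (LinearMap.rTensor R (MulOpposite.opLinearEquiv R (M := A)).toLinearMap)
      (S.counit a.unop)
    rw [LinearMap.rTensor, LinearMap.map_lTensor] at h
    change LinearMap.lTensor _ _ (opMap R A H (S.coact a.unop)) = _
    unfold opMap
    rw [LinearMap.lTensor_map]
    exact h

/-- A left `H`-module coalgebra is a right `Hᵒᵖ`-module coalgebra. -/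
def LeftModuleCoalgebra.op (S : LeftModuleCoalgebra R H C) : RightModuleCoalgebra R Hᵐᵒᵖ C where
  act := (S.act ∘ₗ (MulOpposite.opLinearEquiv R).symm.toLinearMap).flip
  act_one c := S.one_act c
  act_mul c h k := S.mul_act k.unop h.unop c
  comul_act c h := by
    refine (S.comul_act h.unop c).trans ?_
    change _ = TensorProduct.map₂ _ _ _ (opMap R H H (Coalgebra.comul h.unop))
    generalize Coalgebra.comul (R := R) h.unop = x
    generalize Coalgebra.comul (R := R) c = y
    induction x with
    | zero => simp
    | add x x' hx hx' => simp only [map_add, hx, hx', LinearMap.add_apply]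
    | tmul a h =>
      induction y with
      | zero => simp
      | add y y' hy hy' => simp only [map_add, hy, hy', LinearMap.add_apply]
      | tmul b k => simp
  counit_act c h := (S.counit_act h.unop c).trans (mul_comm _ _)

/-- The right-right Doi-Koppinen structure `(Hᵒᵖ, Aᵒᵖ, C)` of a left-right one. -/
def LeftRight.op (S : LeftRight R H A C) : RightRight R Hᵐᵒᵖ Aᵐᵒᵖ C where
  alg := S.alg.op
  coalg := S.coalg.op

end OpStructure

/-! ### Doi-Koppinen modules -/

section Modules

variable {R : Type u₁} {H : Type u₂} {A : Type u₃} {C : Type u₄} [CommRing R]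
  [Ring H] [Bialgebra R H] [Ring A] [Algebra R A] [AddCommGroup C] [Module R C] [Coalgebra R C]

/-- The objects of `M(H)_A^C`: right `A`-modules and right `C`-comodules `M` with
`ϱ(m a) = ∑ m₀ a₀ ⊗ m₁ a₁`. -/
structure RRModule (S : RightRight R H A C) where
  carrier : Type w
  [addCommGroup : AddCommGroup carrier]
  [module : Module R carrier]
  /-- the right action `(m, a) ↦ m a` -/
  act : carrier →ₗ[R] A →ₗ[R] carrier
  act_one : ∀ m, act m 1 = m
  act_mul : ∀ m a b, act m (a * b) = act (act m a) b
  /-- the coaction `m ↦ ∑ m₀ ⊗ m₁` -/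
  coact : carrier →ₗ[R] carrier ⊗[R] C
  coassoc : ∀ m, TensorProduct.assoc R carrier C C (LinearMap.rTensor C coact (coact m)) =
    LinearMap.lTensor carrier Coalgebra.comul (coact m)
  counit : ∀ m, LinearMap.lTensor carrier Coalgebra.counit (coact m) = m ⊗ₜ[R] (1 : R)
  compat : ∀ m a, coact (act m a) = TensorProduct.map₂ act S.coalg.act (coact m) (S.alg.coact a)

attribute [instance] RRModule.addCommGroup RRModule.module

/-- The objects of `_A M(H)^C`: left `A`-modules and right `C`-comodules `M` with
`ϱ(a m) = ∑ a₀ m₀ ⊗ a₁ m₁`. -/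
structure LRModule (S : LeftRight R H A C) where
  carrier : Type w
  [addCommGroup : AddCommGroup carrier]
  [module : Module R carrier]
  /-- the left action `(a, m) ↦ a m` -/
  act : A →ₗ[R] carrier →ₗ[R] carrier
  one_act : ∀ m, act 1 m = m
  mul_act : ∀ a b m, act (a * b) m = act a (act b m)
  /-- the coaction `m ↦ ∑ m₀ ⊗ m₁` -/
  coact : carrier →ₗ[R] carrier ⊗[R] C
  coassoc : ∀ m, TensorProduct.assoc R carrier C C (LinearMap.rTensor C coact (coact m)) =
    LinearMap.lTensor carrier Coalgebra.comul (coact m)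
  counit : ∀ m, LinearMap.lTensor carrier Coalgebra.counit (coact m) = m ⊗ₜ[R] (1 : R)
  compat : ∀ a m, coact (act a m) = TensorProduct.map₂ act S.coalg.act (S.alg.coact a) (coact m)

attribute [instance] LRModule.addCommGroup LRModule.module

/-- `A`-linear `C`-colinear maps. -/
@[ext] structure RRModule.Hom {S : RightRight R H A C} (M N : RRModule.{u₁, u₂, u₃, u₄, w} S) where
  toLin : M.carrier →ₗ[R] N.carrier
  map_act : ∀ m a, toLin (M.act m a) = N.act (toLin m) a
  map_coact : ∀ m, N.coact (toLin m) = LinearMap.rTensor C toLin (M.coact m)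

/-- `A`-linear `C`-colinear maps. -/
@[ext] structure LRModule.Hom {S : LeftRight R H A C} (M N : LRModule.{u₁, u₂, u₃, u₄, w} S) where
  toLin : M.carrier →ₗ[R] N.carrier
  map_act : ∀ a m, toLin (M.act a m) = N.act a (toLin m)
  map_coact : ∀ m, N.coact (toLin m) = LinearMap.rTensor C toLin (M.coact m)

/-- The category `M(H)_A^C`. -/
instance RRModule.category (S : RightRight R H A C) :
    Category (RRModule.{u₁, u₂, u₃, u₄, w} S) where
  Hom := RRModule.Hom
  id M := ⟨LinearMap.id, fun _ _ => rfl, fun m => by simp⟩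
  comp f g := ⟨g.toLin ∘ₗ f.toLin, fun m a => by simp [f.map_act, g.map_act],
    fun m => by simp [f.map_coact, g.map_coact, LinearMap.rTensor_comp]⟩

/-- The category `_A M(H)^C`. -/
instance LRModule.category (S : LeftRight R H A C) :
    Category (LRModule.{u₁, u₂, u₃, u₄, w} S) where
  Hom := LRModule.Hom
  id M := ⟨LinearMap.id, fun _ _ => rfl, fun m => by simp⟩
  comp f g := ⟨g.toLin ∘ₗ f.toLin, fun m a => by simp [f.map_act, g.map_act],
    fun m => by simp [f.map_coact, g.map_coact, LinearMap.rTensor_comp]⟩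

/-- A left-right Doi-Koppinen module over `(H, A, C)` is a right-right one over
`(Hᵒᵖ, Aᵒᵖ, C)`. -/
def LRModule.op {S : LeftRight R H A C} (M : LRModule.{u₁, u₂, u₃, u₄, w} S) :
    RRModule.{u₁, u₂, u₃, u₄, w} S.op where
  carrier := M.carrier
  act := (M.act ∘ₗ (MulOpposite.opLinearEquiv R).symm.toLinearMap).flip
  act_one m := M.one_act m
  act_mul m a b := M.mul_act b.unop a.unop m
  coact := M.coact
  coassoc := M.coassoc
  counit := M.counit
  compat m a := by
    refine (M.compat a.unop m).trans ?_
    change _ = TensorProduct.map₂ _ _ _ (opMap R A H (S.alg.coact a.unop))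
    generalize S.alg.coact a.unop = x
    generalize M.coact m = y
    induction x with
    | zero => simp
    | add x x' hx hx' => simp only [map_add, hx, hx', LinearMap.add_apply]
    | tmul a h =>
      induction y with
      | zero => simp
      | add y y' hy hy' => simp only [map_add, hy, hy', LinearMap.add_apply]
      | tmul b k => simp [LeftRight.op, LeftModuleCoalgebra.op]

/-- The functor `_A M(H)^C ⥤ M(Hᵒᵖ)_{Aᵒᵖ}^C`. -/
def LRModule.opFunctor (S : LeftRight R H A C) :
    LRModule.{u₁, u₂, u₃, u₄, w} S ⥤ RRModule.{u₁, u₂, u₃, u₄, w} S.op where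
  obj M := M.op
  map f := ⟨f.toLin, fun m a => f.map_act a.unop m, f.map_coact⟩

end Modules

/-! ### Modules over rings without unit -/

section NonUnital

variable (R : Type u₁) (T : Type u₂) [CommRing R] [NonUnitalRing T] [Module R T]

/-- Right modules over the `R`-algebra `T`, which need not have a unit. -/
structure RMod where
  carrier : Type w
  [addCommGroup : AddCommGroup carrier]
  [module : Module R carrier]
  /-- the right action `(m, t) ↦ m t` -/
  act : carrier →ₗ[R] T →ₗ[R] carrier
  act_mul : ∀ m s t, act m (s * t) = act (act m s) t

/-- Left modules over the `R`-algebra `T`, which need not have a unit. -/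
structure LMod where
  carrier : Type w
  [addCommGroup : AddCommGroup carrier]
  [module : Module R carrier]
  /-- the left action `(t, m) ↦ t m` -/
  act : T →ₗ[R] carrier →ₗ[R] carrier
  mul_act : ∀ s t m, act (s * t) m = act s (act t m)

attribute [instance] RMod.addCommGroup RMod.module LMod.addCommGroup LMod.module

variable {R T}

/-- `T`-linear maps. -/
@[ext] structure RMod.Hom (M N : RMod.{u₁, u₂, w} R T) where
  toLin : M.carrier →ₗ[R] N.carrier
  map_act : ∀ m t, toLin (M.act m t) = N.act (toLin m) t

/-- `T`-linear maps. -/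
@[ext] structure LMod.Hom (M N : LMod.{u₁, u₂, w} R T) where
  toLin : M.carrier →ₗ[R] N.carrier
  map_act : ∀ t m, toLin (M.act t m) = N.act t (toLin m)

instance RMod.category : Category (RMod.{u₁, u₂, w} R T) where
  Hom := RMod.Hom
  id M := ⟨LinearMap.id, fun _ _ => rfl⟩
  comp f g := ⟨g.toLin ∘ₗ f.toLin, fun m a => by simp [f.map_act, g.map_act]⟩

instance LMod.category : Category (LMod.{u₁, u₂, w} R T) where
  Hom := LMod.Hom
  id M := ⟨LinearMap.id, fun _ _ => rfl⟩
  comp f g := ⟨g.toLin ∘ₗ f.toLin, fun m a => by simp [f.map_act, g.map_act]⟩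

variable (R T)

/-- `M` is unital: `M T = M`. -/
def RMod.IsUnital : ObjectProperty (RMod.{u₁, u₂, w} R T) := fun M =>
  Submodule.span R {x | ∃ m t, M.act m t = x} = ⊤

/-- `M` is unital: `T M = M`. -/
def LMod.IsUnital : ObjectProperty (LMod.{u₁, u₂, w} R T) := fun M =>
  Submodule.span R {x | ∃ t m, M.act t m = x} = ⊤

/-- The category `M_T` of unital right `T`-modules. -/
abbrev UnitalRMod := (RMod.IsUnital.{u₁, u₂, w} R T).FullSubcategory

/-- The category `_T M` of unital left `T`-modules. -/
abbrev UnitalLMod := (LMod.IsUnital.{u₁, u₂, w} R T).FullSubcategory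

/-- A right `T`-module is a left `Tᵒᵖ`-module. -/
def RMod.opFunctor : RMod.{u₁, u₂, w} R T ⥤ LMod.{u₁, u₂, w} R Tᵐᵒᵖ where
  obj M :=
    { carrier := M.carrier
      act := M.act.flip ∘ₗ (MulOpposite.opLinearEquiv R).symm.toLinearMap
      mul_act := fun s t m => M.act_mul m t.unop s.unop }
  map f := ⟨f.toLin, fun t m => f.map_act m t.unop⟩

end NonUnital

/-- `F` is an isomorphism of categories. -/
def IsIsoOfCategories {𝒳 𝒴 : Type*} [Category 𝒳] [Category 𝒴] (F : 𝒳 ⥤ 𝒴) : Prop :=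
  ∃ G : 𝒴 ⥤ 𝒳, F ⋙ G = 𝟭 𝒳 ∧ G ⋙ F = 𝟭 𝒴

/-! ### The coring `𝒞 = A ⊗ C`, its left dual ring and `^□𝒞` -/

section Coring

variable {R : Type u₁} {H : Type u₂} {A : Type u₃} {C : Type u₄} [CommRing R]
  [Ring H] [Bialgebra R H] [Ring A] [Algebra R A] [AddCommGroup C] [Module R C] [Coalgebra R C]

namespace RightRight

/-- The right `A`-action of the `A`-coring `𝒞 = A ⊗ C`: `(b ⊗ c) a = ∑ b a₀ ⊗ c a₁`. The left
`A`-action is `b (a ⊗ c) = b a ⊗ c`. -/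
def coringAct (S : RightRight R H A C) : A ⊗[R] C →ₗ[R] A →ₗ[R] A ⊗[R] C :=
  (TensorProduct.map₂ (LinearMap.mul R A) S.coalg.act).compl₂ S.alg.coact.toLinearMap

/-- The comultiplication `a ⊗ c ↦ ∑ (a ⊗ c₁) ⊗_A (1 ⊗ c₂)` of the coring `𝒞 = A ⊗ C`, with the
indicated representative in `𝒞 ⊗_R 𝒞`. -/
def coringComul (_ : RightRight R H A C) : A ⊗[R] C →ₗ[R] (A ⊗[R] C) ⊗[R] (A ⊗[R] C) :=
  LinearMap.lTensor (A ⊗[R] C) (TensorProduct.mk R A C 1) ∘ₗ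
    (TensorProduct.assoc R A C C).symm.toLinearMap ∘ₗ LinearMap.lTensor A Coalgebra.comul

/-- The left dual `*𝒞` of the `A`-coring `𝒞 = A ⊗ C`: the left `A`-linear maps `𝒞 → A`. -/
def LeftDual (_ : RightRight R H A C) : Type (max u₃ u₄) := A ⊗[R] C →ₗ[A] A

variable (S : RightRight R H A C)

instance : AddCommGroup S.LeftDual := inferInstanceAs (AddCommGroup (A ⊗[R] C →ₗ[A] A))
instance : Module R S.LeftDual := inferInstanceAs (Module R (A ⊗[R] C →ₗ[A] A))
instance : FunLike S.LeftDual (A ⊗[R] C) A := inferInstanceAs (FunLike (A ⊗[R] C →ₗ[A] A) _ _)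
instance : LinearMapClass S.LeftDual A (A ⊗[R] C) A :=
  inferInstanceAs (LinearMapClass (A ⊗[R] C →ₗ[A] A) A _ _)

variable {S}

/-- The underlying `R`-linear map. -/
def LeftDual.lin (f : S.LeftDual) : A ⊗[R] C →ₗ[R] A :=
  LinearMap.restrictScalars R (f : A ⊗[R] C →ₗ[A] A)

@[simp] lemma LeftDual.lin_apply (f : S.LeftDual) (d : A ⊗[R] C) : f.lin d = f d := rfl
@[simp] lemma LeftDual.add_apply (f g : S.LeftDual) (d : A ⊗[R] C) : (f + g) d = f d + g d := rfl
@[simp] lemma LeftDual.zero_apply (d : A ⊗[R] C) : (0 : S.LeftDual) d = 0 := rfl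
@[simp] lemma LeftDual.smul_apply (r : R) (f : S.LeftDual) (d : A ⊗[R] C) :
    (r • f) d = r • f d := rfl

lemma LeftDual.map_smul_left (f : S.LeftDual) (a : A) (d : A ⊗[R] C) : f (a • d) = a * f d :=
  LinearMap.map_smul (f : A ⊗[R] C →ₗ[A] A) a d

lemma LeftDual.map_smul_R (f : S.LeftDual) (r : R) (d : A ⊗[R] C) : f (r • d) = r • f d :=
  f.lin.map_smul r d

lemma LeftDual.ext {f g : S.LeftDual} (h : ∀ c, f (1 ⊗ₜ c) = g (1 ⊗ₜ c)) : f = g := by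
  refine DFunLike.ext _ _ fun d => ?_
  induction d with
  | zero => rw [map_zero, map_zero]
  | add x y hx hy => rw [map_add, map_add, hx, hy]
  | tmul a c =>
    have : a ⊗ₜ[R] c = a • ((1 : A) ⊗ₜ[R] c) := by
      rw [TensorProduct.smul_tmul', smul_eq_mul, mul_one]
    rw [this, f.map_smul_left, g.map_smul_left, h]

@[simp] lemma coringComul_tmul (a : A) (c : C) :
    S.coringComul (a ⊗ₜ c) = LinearMap.lTensor (A ⊗[R] C) (TensorProduct.mk R A C 1)
      ((TensorProduct.assoc R A C C).symm (a ⊗ₜ Coalgebra.comul c)) := rfl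

lemma coringAct_tmul (b : A) (c : C) (a : A) : S.coringAct (b ⊗ₜ c) a =
    TensorProduct.map (LinearMap.mulLeft R b) (S.coalg.act c) (S.alg.coact a) := by
  rfl

lemma coringAct_apply (d : A ⊗[R] C) (a : A) : S.coringAct d a =
    TensorProduct.map₂ (LinearMap.mul R A) S.coalg.act d (S.alg.coact a) := rfl

lemma smul_map₂ (b : A) (d : A ⊗[R] C) (t : A ⊗[R] H) :
    TensorProduct.map₂ (LinearMap.mul R A) S.coalg.act (b • d) t =
      b • TensorProduct.map₂ (LinearMap.mul R A) S.coalg.act d t := by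
  induction d with
  | zero => simp
  | add x y hx hy => simp only [smul_add, map_add, LinearMap.add_apply, hx, hy]
  | tmul a c =>
    induction t with
    | zero => simp
    | add x y hx hy => simp only [smul_add, map_add, hx, hy]
    | tmul p q => simp [TensorProduct.smul_tmul', mul_assoc]

lemma coringAct_smul (b : A) (d : A ⊗[R] C) (a : A) :
    S.coringAct (b • d) a = b • S.coringAct d a := smul_map₂ b d _

lemma coringAct_mul (d : A ⊗[R] C) (a b : A) :
    S.coringAct (S.coringAct d a) b = S.coringAct d (a * b) := by
  simp only [coringAct_apply, map_mul]
  generalize S.alg.coact a = x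
  generalize S.alg.coact b = y
  induction d with
  | zero => simp
  | add d d' hd hd' => simp only [map_add, LinearMap.add_apply, hd, hd']
  | tmul e c =>
    induction x with
    | zero => simp
    | add x x' hx hx' => simp only [map_add, LinearMap.add_apply, add_mul, hx, hx']
    | tmul p q =>
      induction y with
      | zero => simp
      | add y y' hy hy' => simp only [map_add, mul_add, hy, hy']
      | tmul r s => simp [S.coalg.act_mul, mul_assoc]

/-- `x ⊗ y ↦ x f(y)`. -/
def contract (f : S.LeftDual) : (A ⊗[R] C) ⊗[R] (A ⊗[R] C) →ₗ[R] A ⊗[R] C :=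
  TensorProduct.lift (S.coringAct.compl₂ f.lin)

@[simp] lemma contract_tmul (f : S.LeftDual) (x y : A ⊗[R] C) :
    contract f (x ⊗ₜ y) = S.coringAct x (f y) := rfl

lemma contract_comul_smul (f : S.LeftDual) (a : A) (d : A ⊗[R] C) :
    contract f (S.coringComul (a • d)) = a • contract f (S.coringComul d) := by
  induction d with
  | zero => simp
  | add x y hx hy => simp only [smul_add, map_add, hx, hy]
  | tmul b c =>
    rw [TensorProduct.smul_tmul', coringComul_tmul, coringComul_tmul]
    generalize Coalgebra.comul (R := R) c = t
    induction t with
    | zero => simp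
    | add x y hx hy => simp only [TensorProduct.tmul_add, smul_add, map_add, hx, hy]
    | tmul x y => simp [← coringAct_smul, TensorProduct.smul_tmul']

/-- The product `(f ⋆ g)(d) = ∑ g(d₁ f(d₂))` of `*𝒞`. -/
instance : Mul S.LeftDual where
  mul f g := show A ⊗[R] C →ₗ[A] A from
    { toFun := fun d => g (contract f (S.coringComul d))
      map_add' := fun x y => by simp only [map_add]
      map_smul' := fun a d => by
        rw [contract_comul_smul, g.map_smul_left]; rfl }

lemma LeftDual.mul_apply (f g : S.LeftDual) (d : A ⊗[R] C) :
    (f * g) d = g (contract f (S.coringComul d)) := rfl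

lemma contract_add (f g : S.LeftDual) (x : (A ⊗[R] C) ⊗[R] (A ⊗[R] C)) :
    contract (f + g) x = contract f x + contract g x := by
  induction x with
  | zero => simp
  | add x y hx hy => simp only [map_add, hx, hy]; abel
  | tmul x y => simp

lemma contract_zero (x : (A ⊗[R] C) ⊗[R] (A ⊗[R] C)) :
    contract (0 : S.LeftDual) x = 0 := by
  induction x with
  | zero => simp
  | add x y hx hy => simp only [map_add, hx, hy, add_zero]
  | tmul x y => simp

lemma coringComul_coassoc (d : A ⊗[R] C) :
    TensorProduct.assoc R _ _ _ (LinearMap.rTensor _ S.coringComul (S.coringComul d)) =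
      LinearMap.lTensor _ S.coringComul (S.coringComul d) := by
  induction d with
  | zero => simp
  | add x y hx hy => simp only [map_add, hx, hy]
  | tmul a c =>
    have h := Coalgebra.coassoc_apply (R := R) c
    let Θ : C ⊗[R] (C ⊗[R] C) →ₗ[R] (A ⊗[R] C) ⊗[R] ((A ⊗[R] C) ⊗[R] (A ⊗[R] C)) :=
      TensorProduct.map (TensorProduct.mk R A C a)
        (TensorProduct.map (TensorProduct.mk R A C 1) (TensorProduct.mk R A C 1))
    have h' := congrArg Θ h
    have e1 : ∀ t : C ⊗[R] C, Θ (TensorProduct.assoc R C C C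
        (LinearMap.rTensor C Coalgebra.comul t)) =
        TensorProduct.assoc R _ _ _ (LinearMap.rTensor _ S.coringComul
          (LinearMap.lTensor (A ⊗[R] C) (TensorProduct.mk R A C 1)
            ((TensorProduct.assoc R A C C).symm (a ⊗ₜ t)))) := by
      intro t
      induction t with
      | zero => simp
      | add x y hx hy => simp only [TensorProduct.tmul_add, map_add, hx, hy]
      | tmul x y =>
        simp only [LinearMap.rTensor_tmul, TensorProduct.assoc_symm_tmul, LinearMap.lTensor_tmul,
          coringComul_tmul]
        generalize Coalgebra.comul (R := R) x = s
        induction s with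
        | zero => simp
        | add u v hu hv => simp only [TensorProduct.add_tmul, TensorProduct.tmul_add, map_add,
            hu, hv]
        | tmul u v => simp [Θ]
    have e2 : ∀ t : C ⊗[R] C, Θ (LinearMap.lTensor C Coalgebra.comul t) =
        LinearMap.lTensor _ S.coringComul
          (LinearMap.lTensor (A ⊗[R] C) (TensorProduct.mk R A C 1)
            ((TensorProduct.assoc R A C C).symm (a ⊗ₜ t))) := by
      intro t
      induction t with
      | zero => simp
      | add x y hx hy => simp only [TensorProduct.tmul_add, map_add, hx, hy]
      | tmul x y =>
        simp only [TensorProduct.assoc_symm_tmul, LinearMap.lTensor_tmul, TensorProduct.mk_apply,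
          coringComul_tmul]
        generalize Coalgebra.comul (R := R) y = s
        induction s with
        | zero => simp
        | add u v hu hv => simp only [TensorProduct.tmul_add, map_add, hu, hv]
        | tmul u v => simp [Θ]
    rw [e1, e2] at h'
    exact h'

/-- The comultiplication is right `A`-linear, after contraction. -/
lemma contract_comul_act (g : S.LeftDual) (d : A ⊗[R] C) (a : A) :
    contract g (S.coringComul (S.coringAct d a)) =
      contract g (LinearMap.lTensor _ (S.coringAct.flip a) (S.coringComul d)) := by
  induction d with
  | zero => simp
  | add x y hx hy => simp only [map_add, LinearMap.add_apply, hx, hy]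
  | tmul b c =>
    let W : A ⊗[R] (C ⊗[R] C) →ₗ[R] A ⊗[R] (H ⊗[R] H) →ₗ[R] A ⊗[R] (C ⊗[R] C) :=
      TensorProduct.map₂ (LinearMap.mul R A) (TensorProduct.map₂ S.coalg.act S.coalg.act)
    let Z : A ⊗[R] (C ⊗[R] C) →ₗ[R] A ⊗[R] C :=
      contract g ∘ₗ LinearMap.lTensor (A ⊗[R] C) (TensorProduct.mk R A C 1) ∘ₗ
        (TensorProduct.assoc R A C C).symm.toLinearMap
    have e1 : ∀ t : A ⊗[R] H, LinearMap.lTensor A Coalgebra.comul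
        (TensorProduct.map₂ (LinearMap.mul R A) S.coalg.act (b ⊗ₜ c) t) =
        W (b ⊗ₜ Coalgebra.comul c) (LinearMap.lTensor A Coalgebra.comul t) := by
      intro t
      induction t with
      | zero => simp
      | add x y hx hy => simp only [map_add, hx, hy]
      | tmul x y => simp [W, S.coalg.comul_act]
    have e2 : ∀ (s : C ⊗[R] C) (t : A ⊗[R] H),
        contract g (LinearMap.lTensor _ (TensorProduct.map₂ (LinearMap.mul R A) S.coalg.act |>.flip t)
          (LinearMap.lTensor (A ⊗[R] C) (TensorProduct.mk R A C 1)
            ((TensorProduct.assoc R A C C).symm (b ⊗ₜ s)))) =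
        Z (W (b ⊗ₜ s) (TensorProduct.assoc R A H H
          (LinearMap.rTensor H S.alg.coact.toLinearMap t))) := by
      intro s t
      induction s with
      | zero => simp
      | add x y hx hy =>
        simp only [TensorProduct.tmul_add, map_add, LinearMap.add_apply, hx, hy]
      | tmul x y =>
        induction t with
        | zero => simp
        | add u v hu hv =>
          simp only [map_add, LinearMap.lTensor_add, LinearMap.add_apply, hu, hv]
        | tmul p q =>
          have hg : g ((p : A) ⊗ₜ[R] S.coalg.act y q) = p * g (1 ⊗ₜ S.coalg.act y q) := by
            rw [← g.map_smul_left, TensorProduct.smul_tmul', smul_eq_mul, mul_one]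
          simp only [TensorProduct.assoc_symm_tmul, LinearMap.lTensor_tmul, TensorProduct.mk_apply,
            LinearMap.flip_apply, TensorProduct.map₂_apply_tmul, TensorProduct.map_tmul,
            LinearMap.mul_apply', one_mul,
            contract_tmul, hg, LinearMap.rTensor_tmul]
          rw [← coringAct_mul, coringAct_apply (b ⊗ₜ x)]
          change _ = Z (W _ (TensorProduct.assoc R A H H (S.alg.coact p ⊗ₜ q)))
          generalize S.alg.coact p = r
          induction r with
          | zero => simp
          | add u v hu hv =>
            simp only [TensorProduct.add_tmul, map_add, LinearMap.add_apply, hu, hv]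
          | tmul u v => simp [Z, W]
    have h1 := e1 (S.alg.coact a)
    rw [← S.alg.coassoc a] at h1
    have h2 := e2 (Coalgebra.comul c) (S.alg.coact a)
    rw [← h1] at h2
    exact h2.symm

/-- `*𝒞` is an associative ring. -/
instance : NonUnitalRing S.LeftDual :=
  { (inferInstance : AddCommGroup S.LeftDual), (inferInstance : Mul S.LeftDual) with
    left_distrib := fun f g h => DFunLike.ext _ _ fun d => rfl
    right_distrib := fun f g h => DFunLike.ext _ _ fun d => by
      simp only [LeftDual.mul_apply, LeftDual.add_apply, contract_add, map_add]
    zero_mul := fun f => DFunLike.ext _ _ fun d => by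
      simp only [LeftDual.mul_apply, LeftDual.zero_apply, contract_zero, map_zero]
    mul_zero := fun f => DFunLike.ext _ _ fun d => rfl
    mul_assoc := fun f g h => DFunLike.ext _ _ fun d => by
      simp only [LeftDual.mul_apply]
      congr 1
      have h1 := coringComul_coassoc (S := S) d
      let Θ : (A ⊗[R] C) ⊗[R] ((A ⊗[R] C) ⊗[R] (A ⊗[R] C)) →ₗ[R] A ⊗[R] C :=
        contract g ∘ₗ LinearMap.lTensor _ (contract f)
      have e1 : ∀ x, contract (f * g) x = Θ (LinearMap.lTensor _ S.coringComul x) := by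
        intro x
        induction x with
        | zero => simp
        | add x y hx hy => simp only [map_add, hx, hy]
        | tmul x y => simp [Θ, LeftDual.mul_apply]
      have e2 : ∀ x, contract g (S.coringComul (contract f x)) =
          Θ (TensorProduct.assoc R _ _ _ (LinearMap.rTensor _ S.coringComul x)) := by
        intro x
        induction x with
        | zero => simp
        | add x y hx hy => simp only [map_add, hx, hy]
        | tmul x y =>
          rw [contract_tmul, contract_comul_act, LinearMap.rTensor_tmul]
          generalize S.coringComul x = z
          induction z with
          | zero => simp
          | add u v hu hv => simp only [TensorProduct.add_tmul, map_add, hu, hv]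
          | tmul u v => simp [Θ]
      rw [e1, e2, h1] }

/-- `∑ fᵢ ⊗ dᵢ ↦ ∑ fᵢ g(dᵢ)`, where `(f a)(d) = f(d) a`. -/
def leftDualEval (g : S.LeftDual) : S.LeftDual ⊗[R] (A ⊗[R] C) →ₗ[R] S.LeftDual :=
  TensorProduct.lift (LinearMap.mk₂ R
    (fun (f : S.LeftDual) (d : A ⊗[R] C) =>
      (show A ⊗[R] C →ₗ[A] A from
        LinearMap.toSpanSingleton A A (g d) ∘ₗ (f : A ⊗[R] C →ₗ[A] A) : S.LeftDual))
    (fun f f' d => DFunLike.ext _ _ fun x => add_mul (f x) (f' x) (g d))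
    (fun r f d => DFunLike.ext _ _ fun x => smul_mul_assoc r (f x) (g d))
    (fun f d d' => DFunLike.ext _ _ fun x => by
      change f x * g (d + d') = f x * g d + f x * g d'
      rw [map_add, mul_add])
    (fun r f d => DFunLike.ext _ _ fun x => by
      change f x * g (r • d) = r • (f x * g d)
      rw [g.map_smul_R, mul_smul_comm]))

@[simp] lemma leftDualEval_tmul (g f : S.LeftDual) (d x : A ⊗[R] C) :
    leftDualEval g (f ⊗ₜ d) x = f x * g d := rfl

variable (S)

/-- `^□𝒞`, the rational part of `*𝒞` as a right `*𝒞`-module: those `f` for which there is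
`∑ fᵢ ⊗_A dᵢ ∈ *𝒞 ⊗_A 𝒞` with `f ⋆ g = ∑ fᵢ g(dᵢ)` for all `g ∈ *𝒞`. -/
def boxLeftDual : NonUnitalSubalgebra R S.LeftDual where
  carrier := {f | ∃ t : S.LeftDual ⊗[R] (A ⊗[R] C), ∀ g : S.LeftDual, f * g = leftDualEval g t}
  add_mem' := by
    rintro a b ⟨s, hs⟩ ⟨t, ht⟩
    exact ⟨s + t, fun f => by rw [add_mul, hs, ht, map_add]⟩
  zero_mem' := ⟨0, fun f => by rw [zero_mul, map_zero]⟩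
  smul_mem' := by
    rintro r a ⟨s, hs⟩
    refine ⟨r • s, fun g => ?_⟩
    rw [map_smul, ← hs]
    refine DFunLike.ext _ _ fun d => ?_
    simp only [LeftDual.mul_apply, LeftDual.smul_apply]
    rw [← g.map_smul_R]
    congr 1
    generalize S.coringComul d = x
    induction x with
    | zero => simp
    | add x y hx hy => simp only [map_add, smul_add, hx, hy]
    | tmul x y => simp
  mul_mem' := by
    rintro a b ⟨s, hs⟩ -
    refine ⟨LinearMap.lTensor _ (contract b ∘ₗ S.coringComul) s, fun g => ?_⟩
    rw [mul_assoc, hs]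
    clear hs
    induction s with
    | zero => simp
    | add x y hx hy => simp only [map_add, hx, hy]
    | tmul x y => rfl

/-! ### The smash product `A #ᵒᵖ C^□` -/

/-- The left `H`-action on `C*`: `(h f)(c) = f(c h)`. -/
def dualAct : H →ₗ[R] Dual R C →ₗ[R] Dual R C :=
  LinearMap.mk₂ R (fun h f => WithConv.toConv (f.ofConv ∘ₗ S.coalg.act.flip h))
    (fun h k f => by ext c; simp)
    (fun r h f => by ext c; simp)
    (fun h f g => by ext c; rfl)
    (fun r h f => by ext c; rfl)

variable {S}

lemma dualAct_apply (h : H) (f : Dual R C) (c : C) : S.dualAct h f c = f (S.coalg.act c h) := rfl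

lemma dualAct_mul (h k : H) (f : Dual R C) :
    S.dualAct (h * k) f = S.dualAct h (S.dualAct k f) := by
  ext c
  exact congrArg f.ofConv (S.coalg.act_mul c h k)

lemma dualAct_conv (h : H) (f g : Dual R C) : S.dualAct h (f * g) =
    TensorProduct.lift ((LinearMap.mul R (Dual R C)).compl₁₂
      (S.dualAct.flip f) (S.dualAct.flip g)) (Coalgebra.comul h) := by
  ext c
  change LinearMap.mul' R R (TensorProduct.map f.ofConv g.ofConv
    (Coalgebra.comul (S.coalg.act c h))) = _
  rw [S.coalg.comul_act]
  generalize Coalgebra.comul (R := R) h = x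
  induction x with
  | zero => simp
  | add x y hx hy => simp only [map_add, hx, hy]; rfl
  | tmul p q =>
    change _ = LinearMap.mul' R R (TensorProduct.map (S.dualAct p f).ofConv (S.dualAct q g).ofConv
      (Coalgebra.comul c))
    generalize Coalgebra.comul (R := R) c = y
    induction y with
    | zero => simp
    | add x y hx hy => simp only [map_add, LinearMap.add_apply, hx, hy]
    | tmul u v => rfl

end RightRight

/-- `C^□` is a left ideal of `C*`. -/
lemma mul_mem_boxDual (g : Dual R C) {f : Dual R C} (hf : f ∈ boxDual R C) :
    g * f ∈ boxDual R C := by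
  obtain ⟨t, ht⟩ := hf
  -- `∑ fᵢ ⊗ cᵢ ↦ ∑ fᵢ ⊗ cᵢ₁ g(cᵢ₂)`
  refine ⟨LinearMap.lTensor _ ((TensorProduct.rid R C).toLinearMap ∘ₗ
    LinearMap.lTensor C g.ofConv ∘ₗ Coalgebra.comul) t, fun f' => ?_⟩
  rw [← mul_assoc, ht]
  clear ht
  induction t with
  | zero => simp
  | add x y hx hy => simp only [map_add, hx, hy]
  | tmul x c =>
    change (LinearMap.mul' R R (TensorProduct.map f'.ofConv g.ofConv (Coalgebra.comul c))) • x =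
      (f'.ofConv (TensorProduct.rid R C (LinearMap.lTensor C g.ofConv (Coalgebra.comul c)))) • x
    congr 1
    generalize Coalgebra.comul (R := R) c = y
    induction y with
    | zero => simp
    | add x y hx hy => simp only [map_add, hx, hy]
    | tmul u v => simp [mul_comm]

/-- The product `C* × C^□ → C^□`. -/
def mulBox : Dual R C →ₗ[R] boxDual R C →ₗ[R] boxDual R C :=
  LinearMap.mk₂ R (fun g f => ⟨g * f.1, mul_mem_boxDual g f.2⟩)
    (fun g g' f => Subtype.ext (add_mul g g' f.1))
    (fun r g f => Subtype.ext (smul_mul_assoc r g f.1))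
    (fun g f f' => Subtype.ext (mul_add g f.1 f'.1))
    (fun r g f => Subtype.ext (mul_smul_comm r g f.1))

lemma coe_mulBox (g : Dual R C) (f : boxDual R C) : (mulBox g f : Dual R C) = g * f.1 := rfl

lemma mulBox_mul (g g' : Dual R C) (f : boxDual R C) :
    mulBox (g * g') f = mulBox g (mulBox g' f) := Subtype.ext (mul_assoc g g' f.1)

namespace RightRight

variable (S : RightRight R H A C)

/-- `(h, f, g) ↦ (h g) ⋆ f` for `f ∈ C^□`. -/
def twist : H →ₗ[R] boxDual R C →ₗ[R] Dual R C →ₗ[R] boxDual R C :=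
  LinearMap.mk₂ R (fun h f => mulBox.flip f ∘ₗ S.dualAct h)
    (fun h k f => by rw [map_add, LinearMap.comp_add])
    (fun r h f => by rw [map_smul, LinearMap.comp_smul])
    (fun h f g => by rw [map_add, LinearMap.add_comp])
    (fun r h f => by rw [map_smul, LinearMap.smul_comp])

/-- The underlying `R`-module `A ⊗ C^□` of the smash product `A #ᵒᵖ C^□`. -/
def OpSmash (_ : RightRight R H A C) : Type (max u₁ u₃ u₄) := A ⊗[R] boxDual R C

instance : AddCommGroup S.OpSmash := inferInstanceAs (AddCommGroup (A ⊗[R] boxDual R C))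
instance : Module R S.OpSmash := inferInstanceAs (Module R (A ⊗[R] boxDual R C))

/-- `(x ⊗ h) # f, b # g ↦ x b # (h g) ⋆ f`. -/
def smashAux : (A ⊗[R] H) ⊗[R] boxDual R C →ₗ[R] A ⊗[R] boxDual R C →ₗ[R] A ⊗[R] boxDual R C :=
  TensorProduct.map₂ (LinearMap.mul R A)
    (TensorProduct.lift
      (S.twist.compr₂ (LinearMap.lcomp R (boxDual R C) (boxDual R C).subtype))) ∘ₗ
    (TensorProduct.assoc R A H (boxDual R C)).toLinearMap

/-- The product `(a # f)(b # g) = ∑ a₀ b # (a₁ g) ⋆ f`. -/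
def smashMul : A ⊗[R] boxDual R C →ₗ[R] A ⊗[R] boxDual R C →ₗ[R] A ⊗[R] boxDual R C :=
  S.smashAux ∘ₗ LinearMap.rTensor (boxDual R C) S.alg.coact.toLinearMap

variable {S}

lemma smashAux_tmul (x : A) (h : H) (f : boxDual R C) (b : A) (g : boxDual R C) :
    S.smashAux ((x ⊗ₜ h) ⊗ₜ f) (b ⊗ₜ g) = (x * b) ⊗ₜ S.twist h f g := rfl

lemma smashMul_tmul (a : A) (f : boxDual R C) (y : A ⊗[R] boxDual R C) :
    S.smashMul (a ⊗ₜ f) y = S.smashAux (S.alg.coact a ⊗ₜ f) y := rfl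

lemma smashMul_assoc (x y z : A ⊗[R] boxDual R C) :
    S.smashMul (S.smashMul x y) z = S.smashMul x (S.smashMul y z) := by
  induction x with
  | zero => simp
  | add x x' hx hx' => simp only [map_add, LinearMap.add_apply, hx, hx']
  | tmul a f =>
  induction y with
  | zero => simp
  | add x x' hx hx' => simp only [map_add, LinearMap.add_apply, hx, hx']
  | tmul b g =>
  induction z with
  | zero => simp
  | add x x' hx hx' => simp only [map_add, hx, hx']
  | tmul d k =>
  -- `r ⊗ s ↦ p ⊗ q ⊗ h ↦ p r d # ((q s k) ⋆ (h g)) ⋆ f`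
  let P : H →ₗ[R] boxDual R C := LinearMap.applyₗ (g : Dual R C) ∘ₗ S.twist.flip f
  let Ω : A ⊗[R] H →ₗ[R] A ⊗[R] (H ⊗[R] H) →ₗ[R] A ⊗[R] boxDual R C :=
    TensorProduct.map₂ ((LinearMap.mul R A).flip.compr₂ (LinearMap.mulRight R d))
      ((TensorProduct.lift (S.twist.compl₂ P)).flip ∘ₗ S.dualAct.flip k)
  have hΩ : ∀ r s p q h, Ω (r ⊗ₜ s) (p ⊗ₜ (q ⊗ₜ h)) =
      ((p * r) * d) ⊗ₜ mulBox (S.dualAct q (S.dualAct s k)) (mulBox (S.dualAct h g) f) :=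
    fun _ _ _ _ _ => rfl
  have e1 : ∀ t : A ⊗[R] H, S.smashMul (S.smashAux (t ⊗ₜ f) (b ⊗ₜ g)) (d ⊗ₜ k) =
      Ω (S.alg.coact b) (TensorProduct.assoc R A H H
        (LinearMap.rTensor H S.alg.coact.toLinearMap t)) := by
    intro t
    induction t with
    | zero => simp
    | add x y hx hy => simp only [TensorProduct.add_tmul, map_add, LinearMap.add_apply, hx, hy]
    | tmul a' h =>
      rw [smashAux_tmul, smashMul_tmul, map_mul]
      change _ = Ω (S.alg.coact b) (TensorProduct.assoc R A H H (S.alg.coact a' ⊗ₜ h))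
      generalize S.alg.coact b = v
      generalize S.alg.coact a' = u
      induction u with
      | zero => simp
      | add x y hx hy =>
        simp only [TensorProduct.add_tmul, map_add, LinearMap.add_apply, add_mul, hx, hy]
      | tmul p q =>
        induction v with
        | zero => simp
        | add x y hx hy =>
          simp only [TensorProduct.add_tmul, map_add, LinearMap.add_apply, mul_add, hx, hy]
        | tmul r s =>
          rw [Algebra.TensorProduct.tmul_mul_tmul, smashAux_tmul, TensorProduct.assoc_tmul, hΩ,
            ← dualAct_mul]
          rfl
  have e2 : ∀ v t : A ⊗[R] H, S.smashAux (t ⊗ₜ f) (S.smashAux (v ⊗ₜ g) (d ⊗ₜ k)) =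
      Ω v (LinearMap.lTensor A Coalgebra.comul t) := by
    intro v t
    induction v with
    | zero => simp
    | add x y hx hy => simp only [TensorProduct.add_tmul, map_add, LinearMap.add_apply, hx, hy]
    | tmul r s =>
      induction t with
      | zero => simp
      | add x y hx hy => simp only [TensorProduct.add_tmul, map_add, LinearMap.add_apply, hx, hy]
      | tmul p h =>
        rw [smashAux_tmul, smashAux_tmul, LinearMap.lTensor_tmul]
        have e3 : S.twist h f (S.twist s g k) = TensorProduct.lift (S.twist.compl₂ P)
            (Coalgebra.comul h) (S.dualAct s k) := by
          change mulBox (S.dualAct h (S.dualAct s k * g)) f = _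
          rw [dualAct_conv]
          generalize Coalgebra.comul (R := R) h = w
          induction w with
          | zero => simp
          | add x y hx hy => simp only [map_add, LinearMap.add_apply, hx, hy]
          | tmul q h' =>
            change mulBox (S.dualAct q (S.dualAct s k) * S.dualAct h' g) f = _
            rw [mulBox_mul]
            rfl
        rw [e3, ← mul_assoc]
        rfl
  rw [smashMul_tmul, e1, S.alg.coassoc, ← e2, smashMul_tmul, smashMul_tmul]

/-- The ring `A #ᵒᵖ C^□`, with product `(a # f)(b # g) = ∑ a₀ b # (a₁ g) ⋆ f`. -/
instance : NonUnitalRing S.OpSmash :=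
  { (inferInstance : AddCommGroup S.OpSmash) with
    mul := fun x y => S.smashMul x y
    left_distrib := fun x y z => map_add (S.smashMul x) y z
    right_distrib := fun x y z => LinearMap.map_add₂ S.smashMul x y z
    zero_mul := fun x => LinearMap.map_zero₂ S.smashMul x
    mul_zero := fun x => map_zero (S.smashMul x)
    mul_assoc := smashMul_assoc }

lemma OpSmash.mul_def (x y : S.OpSmash) : x * y = S.smashMul x y := rfl

variable (S)

/-- `a # f ↦ (b ⊗ c ↦ b a f(c))`, from `A #ᵒᵖ C^□` to `*𝒞`. -/
def smashToLeftDual : A ⊗[R] boxDual R C →ₗ[R] S.LeftDual :=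
  TensorProduct.lift (LinearMap.mk₂ R
    (fun (a : A) (f : boxDual R C) =>
      (show A ⊗[R] C →ₗ[A] A from TensorProduct.AlgebraTensorModule.lift
        (LinearMap.toSpanSingleton A (C →ₗ[R] A)
          (LinearMap.toSpanSingleton R A a ∘ₗ f.1.ofConv)) : S.LeftDual))
    (fun a a' f => LeftDual.ext fun c => by
      change 1 * (f.1 c • (a + a')) = 1 * (f.1 c • a) + 1 * (f.1 c • a')
      rw [smul_add, mul_add])
    (fun r a f => LeftDual.ext fun c => by
      change 1 * (f.1 c • r • a) = r • (1 * (f.1 c • a))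
      rw [one_mul, one_mul, smul_comm])
    (fun a f f' => LeftDual.ext fun c => by
      change 1 * ((f.1 c + f'.1 c) • a) = 1 * (f.1 c • a) + 1 * (f'.1 c • a)
      rw [add_smul, mul_add])
    (fun r a f => LeftDual.ext fun c => by
      change 1 * ((r • f.1 c) • a) = r • (1 * (f.1 c • a))
      rw [one_mul, one_mul, smul_assoc]))

variable {S}

lemma smashToLeftDual_tmul (a : A) (f : boxDual R C) (b : A) (c : C) :
    S.smashToLeftDual (a ⊗ₜ f) (b ⊗ₜ c) = b * (f.1 c • a) := rfl

lemma coringComul_one_tmul (c : C) : S.coringComul (1 ⊗ₜ c) =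
    TensorProduct.map (TensorProduct.mk R A C 1) (TensorProduct.mk R A C 1)
      (Coalgebra.comul c) := by
  rw [coringComul_tmul]
  generalize Coalgebra.comul (R := R) c = s
  induction s with
  | zero => simp
  | add x y hx hy => simp only [TensorProduct.tmul_add, map_add, hx, hy]
  | tmul x y => rfl

lemma smashToLeftDual_mul (x y : A ⊗[R] boxDual R C) :
    S.smashToLeftDual (S.smashMul x y) = S.smashToLeftDual x * S.smashToLeftDual y := by
  induction x with
  | zero => simp
  | add x x' hx hx' => simp only [map_add, LinearMap.add_apply, add_mul, hx, hx']
  | tmul a f =>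
  induction y with
  | zero => simp
  | add x x' hx hx' => simp only [map_add, mul_add, hx, hx']
  | tmul b g =>
  refine LeftDual.ext fun c => ?_
  rw [LeftDual.mul_apply, smashMul_tmul, coringComul_one_tmul]
  have e1 : ∀ s : C ⊗[R] C, contract (S.smashToLeftDual (a ⊗ₜ f)) (TensorProduct.map
      (TensorProduct.mk R A C 1) (TensorProduct.mk R A C 1) s) =
      S.coringAct (1 ⊗ₜ TensorProduct.rid R C (LinearMap.lTensor C f.1.ofConv s)) a := by
    intro s
    induction s with
    | zero => simp
    | add x y hx hy =>
      simp only [map_add, hx, hy, TensorProduct.tmul_add, LinearMap.add_apply]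
    | tmul x y =>
      simp [smashToLeftDual_tmul]
  have e2 : ∀ (q : H) (s : C ⊗[R] C),
      LinearMap.mul' R R (TensorProduct.map (S.dualAct q g.1).ofConv f.1.ofConv s) =
      g.1.ofConv (S.coalg.act (TensorProduct.rid R C (LinearMap.lTensor C f.1.ofConv s)) q) := by
    intro q s
    induction s with
    | zero => simp
    | add x y hx hy => simp only [map_add, hx, hy, LinearMap.add_apply]
    | tmul x y => simp [mul_comm, dualAct]
  rw [e1, coringAct_apply]
  generalize S.alg.coact a = t
  induction t with
  | zero => simp
  | add x y hx hy => simp only [TensorProduct.add_tmul, map_add, LinearMap.add_apply,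
      LeftDual.add_apply, hx, hy]
  | tmul p q =>
    rw [smashAux_tmul, TensorProduct.map₂_apply_tmul, smashToLeftDual_tmul,
      TensorProduct.map_tmul, LinearMap.mul_apply', smashToLeftDual_tmul, one_mul, one_mul, mul_smul_comm]
    congr 1
    exact e2 q _

end RightRight

/-! ### The canonical functors -/

namespace RRModule

variable {S : RightRight R H A C} (M : RRModule.{u₁, u₂, u₃, u₄, w} S)

/-- `n ⊗ c ↦ n f(1 ⊗ c)`. -/
def evalDual (f : S.LeftDual) : M.carrier ⊗[R] C →ₗ[R] M.carrier :=
  TensorProduct.lift (M.act.compl₂ (f.lin ∘ₗ TensorProduct.mk R A C 1))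

lemma evalDual_tmul (f : S.LeftDual) (n : M.carrier) (c : C) :
    M.evalDual f (n ⊗ₜ c) = M.act n (f (1 ⊗ₜ c)) := rfl

/-- The action `m f = ∑ m₀ f(1 ⊗ m₁)` of `*𝒞` on a Doi-Koppinen module. -/
def dualAction : M.carrier →ₗ[R] S.LeftDual →ₗ[R] M.carrier :=
  LinearMap.mk₂ R (fun m f => M.evalDual f (M.coact m))
    (fun m n f => by rw [map_add, map_add])
    (fun r m f => by rw [map_smul, map_smul])
    (fun m f g => by
      generalize M.coact m = x
      induction x with
      | zero => simp
      | add x y hx hy => simp only [map_add, hx, hy]; abel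
      | tmul n c => simp [evalDual_tmul])
    (fun r m f => by
      generalize M.coact m = x
      induction x with
      | zero => simp
      | add x y hx hy => simp only [map_add, hx, hy, smul_add]
      | tmul n c => simp [evalDual_tmul])

lemma dualAction_apply (m : M.carrier) (f : S.LeftDual) :
    M.dualAction m f = M.evalDual f (M.coact m) := rfl

lemma dualAction_mul (m : M.carrier) (f g : S.LeftDual) :
    M.dualAction m (f * g) = M.dualAction (M.dualAction m f) g := by
  simp only [dualAction_apply]
  -- `n ⊗ x ⊗ y ↦ n g((1 ⊗ x) f(1 ⊗ y))`
  let Θ : M.carrier ⊗[R] (C ⊗[R] C) →ₗ[R] M.carrier :=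
    TensorProduct.lift (M.act.compl₂ (g.lin ∘ₗ RightRight.contract f ∘ₗ
      TensorProduct.map (TensorProduct.mk R A C 1) (TensorProduct.mk R A C 1)))
  have e1 : ∀ x, M.evalDual (f * g) x = Θ (LinearMap.lTensor _ Coalgebra.comul x) := by
    intro x
    induction x with
    | zero => simp
    | add x y hx hy => simp only [map_add, hx, hy]
    | tmul n c =>
      rw [evalDual_tmul, RightRight.LeftDual.mul_apply, RightRight.coringComul_one_tmul]
      rfl
  have e3 : ∀ y t, M.evalDual g (TensorProduct.map₂ M.act S.coalg.act y t) =
      TensorProduct.lift (M.act.compl₂ (g.lin ∘ₗ (TensorProduct.map₂ (LinearMap.mul R A)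
        S.coalg.act).flip t ∘ₗ TensorProduct.mk R A C 1)) y := by
    intro y t
    induction y with
    | zero => simp
    | add x y hx hy => simp only [map_add, LinearMap.add_apply, hx, hy]
    | tmul n c =>
      induction t with
      | zero => simp
      | add x y hx hy =>
        rw [map_add, map_add, hx, hy]
        simp
      | tmul p q =>
        have hg : g ((p : A) ⊗ₜ[R] S.coalg.act c q) = p * g (1 ⊗ₜ S.coalg.act c q) := by
          rw [← g.map_smul_left, TensorProduct.smul_tmul', smul_eq_mul, mul_one]
        simp [evalDual_tmul, hg, M.act_mul]
  have e2 : ∀ x, M.evalDual g (M.coact (M.evalDual f x)) =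
      Θ (TensorProduct.assoc R _ _ _ (LinearMap.rTensor _ M.coact x)) := by
    intro x
    induction x with
    | zero => simp
    | add x y hx hy => simp only [map_add, hx, hy]
    | tmul n c =>
      rw [evalDual_tmul, M.compat, e3, LinearMap.rTensor_tmul]
      generalize M.coact n = z
      induction z with
      | zero => simp
      | add x y hx hy => simp only [TensorProduct.add_tmul, map_add, hx, hy]
      | tmul x y => rfl
  rw [e1, e2, M.coassoc]

end RRModule

variable (S : RightRight R H A C)

lemma RRModule.Hom.map_dualAction {S : RightRight R H A C}
    {M N : RRModule.{u₁, u₂, u₃, u₄, w} S} (φ : M.Hom N) (m : M.carrier) (f : S.LeftDual) :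
    φ.toLin (M.dualAction m f) = N.dualAction (φ.toLin m) f := by
  rw [RRModule.dualAction_apply, RRModule.dualAction_apply, φ.map_coact]
  generalize M.coact m = x
  induction x with
  | zero => simp
  | add x y hx hy => simp only [map_add, hx, hy]
  | tmul n c => simp [RRModule.evalDual_tmul, φ.map_act]

/-- The functor from `M(H)_A^C` to right `A #ᵒᵖ C^□`-modules, with
`m (a # f) = ∑ f(m₁) m₀ a`; it does not change underlying modules and maps. -/
def toOpSmash : RRModule.{u₁, u₂, u₃, u₄, w} S ⥤ RMod.{u₁, max u₁ u₃ u₄, w} R S.OpSmash where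
  obj M :=
    { carrier := M.carrier
      act := M.dualAction.compl₂ S.smashToLeftDual
      act_mul := fun m s t =>
        (congrArg (M.dualAction m) (RightRight.smashToLeftDual_mul (S := S) s t)).trans
          (M.dualAction_mul m _ _) }
  map φ := ⟨φ.toLin, fun m _ => φ.map_dualAction m _⟩

/-- The functor from `M(H)_A^C` to right `^□𝒞`-modules, with `m f = ∑ m₀ f(1 ⊗ m₁)`; it does not
change underlying modules and maps. -/
def toBoxDual : RRModule.{u₁, u₂, u₃, u₄, w} S ⥤ RMod.{u₁, max u₃ u₄, w} R S.boxLeftDual where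
  obj M :=
    { carrier := M.carrier
      act := M.dualAction.compl₂ S.boxLeftDual.toSubmodule.subtype
      act_mul := fun m s t => M.dualAction_mul m s.1 t.1 }
  map φ := ⟨φ.toLin, fun m _ => φ.map_dualAction m _⟩

end Coring

/-! ### The left-right case -/

section LeftRightCase

variable {R : Type u₁} {H : Type u₂} {A : Type u₃} {C : Type u₄} [CommRing R]
  [Ring H] [Bialgebra R H] [Ring A] [Algebra R A] [AddCommGroup C] [Module R C] [Coalgebra R C]
  (S : LeftRight R H A C)

/-- The smash product `A # C^□ := (Aᵒᵖ #ᵒᵖ C^□)ᵒᵖ` of a left-right Doi-Koppinen structure. Its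
product is `(a # f)(b # g) = ∑ a b₀ # (f b₁) ⋆ g`, where `(f h)(c) = f(h c)`. -/
abbrev LeftRight.Smash : Type (max u₁ u₃ u₄) := (S.op.OpSmash)ᵐᵒᵖ

/-- The functor from `_A M(H)^C` to left `A # C^□`-modules, with
`(a # f) m = ∑ f(m₁) a m₀`. -/
def toSmash : LRModule.{u₁, u₂, u₃, u₄, w} S ⥤ LMod.{u₁, max u₁ u₃ u₄, w} R S.Smash :=
  LRModule.opFunctor S ⋙ toOpSmash S.op ⋙ RMod.opFunctor R S.op.OpSmash

/-- The functor from `_A M(H)^C` to left `(^□𝒟)ᵒᵖ`-modules, where `𝒟 = Aᵒᵖ ⊗ C` is the coring of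
`(Hᵒᵖ, Aᵒᵖ, C)`, with `f m = ∑ f(1 ⊗ m₁) m₀`. -/
def toBoxDualOp :
    LRModule.{u₁, u₂, u₃, u₄, w} S ⥤ LMod.{u₁, max u₃ u₄, w} R (S.op.boxLeftDual)ᵐᵒᵖ :=
  LRModule.opFunctor S ⋙ toBoxDual S.op ⋙ RMod.opFunctor R S.op.boxLeftDual

end LeftRightCase

end

end DoiKoppinen

/-!
Coproperness makes `C^□` dense in `C*`, and local projectivity gives each finite subset of `C` a
finite system of dual bases with functionals in `C^□`. So `M ⊗ C → Hom(C^□, M)` is injective, and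
a `C`-coaction is determined by the contractions of its second leg with `C^□`.

Conversely, let `N` be a unital `A #ᵒᵖ C^□`-module. The product of `A #ᵒᵖ C^□` extends to factors
`a # h` on the right with `h ∈ C*` arbitrary, in particular with `h` the counit. Elements `n s` span
`N`, and there `(n s) a` can only be `n (s (a # ε))`, while the value of the coaction under `f` can
only be `n (s (1 # f))`. Rationality of `C^□` shows that these values come from an element of
`N ⊗ C`, and density shows that this element does not depend on the way the elements `n s` are
written.

The elements of `^□𝒞` see only finitely many elements of `C`, so for `f, g ∈ ^□𝒞` the product `f g`
is equal to `f θ(s)` with `θ` the canonical morphism `A #ᵒᵖ C^□ → ^□𝒞`. Restriction of scalars along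
`θ` is therefore fully faithful on unital modules and preserves unitality, which reduces `^□𝒞` to
`A #ᵒᵖ C^□`. Left-right structures are the right-right structures over the opposite algebras.
-/

namespace DoiKoppinen

open TensorProduct CategoryTheory

noncomputable section

/-! ### Isomorphisms of categories -/

section Category

variable {𝒳 𝒴 𝒵 : Type*} [Category 𝒳] [Category 𝒴] [Category 𝒵]

/-- A functor that induces an isomorphism from its source to the full subcategory of the objects
satisfying `P`. It is stated without the lifted functor, so that it composes. -/
structure IsIsoOnto (F : 𝒳 ⥤ 𝒴) (P : ObjectProperty 𝒴) : Prop where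
  full : F.Full
  faithful : F.Faithful
  injective : Function.Injective F.obj
  mem_iff : ∀ Y, P Y ↔ ∃ X, F.obj X = Y

lemma isIsoOfCategories_of_bijective (F : 𝒳 ⥤ 𝒴) [F.Full] [F.Faithful]
    (hF : Function.Bijective F.obj) : IsIsoOfCategories F := by
  choose g hg using hF.2
  let G : 𝒴 ⥤ 𝒳 :=
    { obj := g
      map := fun {X Y} f => F.preimage (eqToHom (hg X) ≫ f ≫ eqToHom (hg Y).symm)
      map_id := fun X => F.map_injective (by simp)
      map_comp := fun f f' => F.map_injective (by simp) }
  refine ⟨G, ?_, ?_⟩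
  · refine CategoryTheory.Functor.ext (fun X => hF.1 (hg _)) fun X Y f => F.map_injective ?_
    simp [G, eqToHom_map]
  · refine CategoryTheory.Functor.ext hg fun X Y f => ?_
    simp [G]

namespace IsIsoOnto

variable {F : 𝒳 ⥤ 𝒴} {G : 𝒴 ⥤ 𝒵} {P : ObjectProperty 𝒴} {Q : ObjectProperty 𝒵}

lemma exists_lift (hF : IsIsoOnto F P) :
    ∃ h : ∀ X, P (F.obj X), IsIsoOfCategories (P.lift F h) := by
  have := hF.full
  have := hF.faithful
  refine ⟨fun X => (hF.mem_iff _).2 ⟨X, rfl⟩, isIsoOfCategories_of_bijective _ ⟨?_, ?_⟩⟩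
  · intro X Y h
    exact hF.injective (congrArg ObjectProperty.FullSubcategory.obj h)
  · rintro ⟨Y, hY⟩
    obtain ⟨X, rfl⟩ := (hF.mem_iff Y).1 hY
    exact ⟨X, rfl⟩

lemma comp {P' : ObjectProperty 𝒵} (hF : IsIsoOnto F P) (hG : IsIsoOnto G Q) (hQ : P' ≤ Q)
    (hP : ∀ Y, P' (G.obj Y) ↔ P Y) : IsIsoOnto (F ⋙ G) P' where
  full := have := hF.full; have := hG.full; inferInstance
  faithful := have := hF.faithful; have := hG.faithful; inferInstance
  injective := hG.injective.comp hF.injective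
  mem_iff Z := by
    constructor
    · intro hZ
      obtain ⟨Y, rfl⟩ := (hG.mem_iff Z).1 (hQ Z hZ)
      obtain ⟨X, rfl⟩ := (hF.mem_iff Y).1 ((hP Y).1 hZ)
      exact ⟨X, rfl⟩
    · rintro ⟨X, rfl⟩
      exact (hP _).2 ((hF.mem_iff _).2 ⟨X, rfl⟩)

lemma of_comp [G.Faithful] (h : IsIsoOnto (F ⋙ G) Q) (hF : ∀ X, P (F.obj X))
    (hG : ∀ Y, P Y → Q (G.obj Y))
    (hinj : ∀ Y Y', P Y → P Y' → G.obj Y = G.obj Y' → Y = Y') : IsIsoOnto F P where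
  full := have := h.full; Functor.Full.of_comp_faithful F G
  faithful := have := h.faithful; Functor.Faithful.of_comp F G
  injective _ _ hX := h.injective (congrArg G.obj hX)
  mem_iff Y := by
    constructor
    · intro hY
      obtain ⟨X, hX⟩ := (h.mem_iff _).1 (hG Y hY)
      exact ⟨X, hinj _ _ (hF X) hY hX⟩
    · rintro ⟨X, rfl⟩
      exact hF X

end IsIsoOnto

end Category

/-! ### Unital modules over non-unital algebras -/

section NonUnital

variable {R : Type u₁} [CommRing R] {T : Type u₂} [NonUnitalRing T] [Module R T]

namespace RMod

lemma IsUnital.mem {N : RMod.{u₁, u₂, w} R T} (hN : RMod.IsUnital R T N)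
    {p : Submodule R N.carrier} (h : ∀ n t, N.act n t ∈ p) (n : N.carrier) : n ∈ p := by
  have htop : (⊤ : Submodule R N.carrier) ≤ p := by
    rw [← show _ = ⊤ from hN, Submodule.span_le]
    rintro _ ⟨m, t, rfl⟩
    exact h m t
  exact htop trivial

lemma IsUnital.linearMap_ext {N : RMod.{u₁, u₂, w} R T} (hN : RMod.IsUnital R T N)
    {P : Type*} [AddCommMonoid P] [Module R P] {φ ψ : N.carrier →ₗ[R] P}
    (h : ∀ n t, φ (N.act n t) = ψ (N.act n t)) : φ = ψ :=
  LinearMap.ext (hN.mem (p := LinearMap.eqLocus φ ψ) h)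

variable {T' : Type u₃} [NonUnitalRing T'] [Module R T'] (θ : T →ₙₐ[R] T')

/-- Restriction of scalars along a morphism of non-unital algebras. -/
def restrictScalars : RMod.{u₁, u₃, w} R T' ⥤ RMod.{u₁, u₂, w} R T where
  obj N :=
    { carrier := N.carrier
      act := N.act.compl₂ (θ : T →ₗ[R] T')
      act_mul := fun m s t => (congrArg (N.act m) (map_mul θ s t)).trans (N.act_mul m _ _) }
  map φ := ⟨φ.toLin, fun m t => φ.map_act m (θ t)⟩

instance : (restrictScalars.{u₁, u₂, u₃, w} θ).Faithful where
  map_injective {_ _ φ ψ} h := by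
    have hlin : RMod.Hom.toLin φ = RMod.Hom.toLin ψ := congrArg (RMod.Hom.toLin (T := T)) h
    exact RMod.Hom.ext hlin

variable {θ}

lemma IsUnital.of_restrictScalars_obj {N : RMod.{u₁, u₃, w} R T'}
    (hN : RMod.IsUnital R T ((restrictScalars θ).obj N)) : RMod.IsUnital R T' N := by
  refine eq_top_iff.2 ((eq_top_iff.1 hN).trans (Submodule.span_mono ?_))
  rintro _ ⟨m, t, rfl⟩
  exact ⟨m, θ t, rfl⟩

variable (hθ : ∀ f g : T', ∃ t : T, f * g = f * θ t)
include hθ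

lemma IsUnital.restrictScalars_obj {N : RMod.{u₁, u₃, w} R T'} (hN : RMod.IsUnital R T' N) :
    RMod.IsUnital R T ((restrictScalars θ).obj N) := by
  let p : Submodule R N.carrier := Submodule.span R {x | ∃ m t, N.act m (θ t) = x}
  have hmul (m : N.carrier) (f g : T') : N.act (N.act m f) g ∈ p := by
    obtain ⟨t, ht⟩ := hθ f g
    rw [← N.act_mul, ht, N.act_mul]
    exact Submodule.subset_span ⟨_, t, rfl⟩
  exact Submodule.eq_top_iff'.2 <| hN.mem (p := p) fun n g =>
    hN.mem (p := p.comap (N.act.flip g)) (fun m f => hmul m f g) n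

lemma IsUnital.map_act_of_restrictScalars {N N' : RMod.{u₁, u₃, w} R T'}
    (hN : RMod.IsUnital R T' N) (φ : N.carrier →ₗ[R] N'.carrier)
    (hφ : ∀ m t, φ (N.act m (θ t)) = N'.act (φ m) (θ t)) (m : N.carrier) (g : T') :
    φ (N.act m g) = N'.act (φ m) g := by
  suffices φ ∘ₗ N.act.flip g = N'.act.flip g ∘ₗ φ from LinearMap.congr_fun this m
  refine (hN.restrictScalars_obj hθ).linearMap_ext fun (n : N.carrier) s => ?_
  obtain ⟨t, ht⟩ := hθ (θ s) g
  calc φ (N.act (N.act n (θ s)) g) = φ (N.act n (θ (s * t))) := by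
        rw [← N.act_mul, ht, ← map_mul θ]
    _ = N'.act (φ n) (θ s * g) := by rw [hφ, map_mul θ, ht]
    _ = N'.act (φ (N.act n (θ s))) g := by rw [N'.act_mul, hφ]

lemma IsUnital.eq_of_restrictScalars_obj_eq {N N' : RMod.{u₁, u₃, w} R T'}
    (hN : RMod.IsUnital R T' N) (h : (restrictScalars θ).obj N = (restrictScalars θ).obj N') :
    N = N' := by
  obtain ⟨M, α, hα⟩ := N
  obtain ⟨M', β, hβ⟩ := N'
  injection h with hM hadd hmod hact
  subst hM
  obtain rfl := eq_of_heq hadd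
  obtain rfl := eq_of_heq hmod
  have hαβ : α = β := LinearMap.ext₂ <|
    IsUnital.map_act_of_restrictScalars (N' := ⟨M, β, hβ⟩) hθ hN LinearMap.id
      fun m t => LinearMap.congr_fun₂ (eq_of_heq hact) m t
  subst hαβ
  rfl

end RMod

end NonUnital

/-! ### Evaluating the coalgebra leg of a tensor -/

section Eval

variable {R : Type u₁} {C : Type u₄} [CommRing R] [AddCommGroup C] [Module R C]
  {M N : Type*} [AddCommMonoid M] [Module R M] [AddCommMonoid N] [Module R N]

/-- Contraction of the second leg of a tensor with a functional, `m ⊗ c ↦ f(c) m`. -/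
def evalRight : Dual R C →ₗ[R] M ⊗[R] C →ₗ[R] M :=
  LinearMap.compRight R (TensorProduct.rid R M).toLinearMap ∘ₗ LinearMap.lTensorHom M ∘ₗ
    (WithConv.linearEquiv R (C →ₗ[R] R)).toLinearMap

@[simp] lemma evalRight_tmul (f : Dual R C) (m : M) (c : C) : evalRight f (m ⊗ₜ[R] c) = f c • m :=
  rfl

lemma evalRight_rTensor (f : Dual R C) (φ : M →ₗ[R] N) (t : M ⊗[R] C) :
    evalRight f (LinearMap.rTensor C φ t) = φ (evalRight f t) := by
  induction t with
  | zero => simp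
  | add x y hx hy => simp only [map_add, hx, hy]
  | tmul m c => simp

lemma evalRight_evalRight_assoc_symm (f g : Dual R C) (t : M ⊗[R] (C ⊗[R] C)) :
    evalRight f (evalRight g ((TensorProduct.assoc R M C C).symm t)) =
      evalRight f (LinearMap.lTensor M (evalRight g) t) := by
  induction t with
  | zero => simp
  | add x y hx hy => simp only [map_add, hx, hy]
  | tmul m y =>
    induction y with
    | zero => simp
    | add x y hx hy => simp only [tmul_add, map_add, hx, hy]
    | tmul u v => simp

lemma IsLocallyProjective.exists_linearCombination_eq (hC : IsLocallyProjective R C)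
    (F : Finset C) :
    ∃ h : C →ₗ[R] (C →₀ R), ∀ c ∈ F, Finsupp.linearCombination R id (h c) = c := by
  obtain ⟨h, hh⟩ := hC (Submodule.span R F) ⟨F, rfl⟩ (C →₀ R) (ULift.{u₁} C)
    (ULift.moduleEquiv.symm.toLinearMap ∘ₗ Finsupp.linearCombination R id)
    (ULift.moduleEquiv.symm.surjective.comp (Finsupp.linearCombination_id_surjective R C))
    ULift.moduleEquiv.symm.toLinearMap
  exact ⟨h, fun c hc => ULift.moduleEquiv.symm.injective (hh c (Submodule.subset_span hc))⟩

/-- Contraction of the first leg of a tensor in `D ⊗ C` with an element of `C`,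
`f ⊗ x ↦ f(c) x`. -/
def evalLeft {D : Submodule R (Dual R C)} (c : C) : D ⊗[R] C →ₗ[R] C :=
  TensorProduct.lift (LinearMap.lsmul R C ∘ₗ LinearMap.applyₗ c ∘ₗ
    (WithConv.linearEquiv R (C →ₗ[R] R)).toLinearMap ∘ₗ D.subtype)

lemma evalLeft_tmul {D : Submodule R (Dual R C)} (c : C) (f : D) (x : C) :
    evalLeft c (f ⊗ₜ[R] x) = f.1 c • x := rfl

lemma apply_evalLeft {D : Submodule R (Dual R C)} (h : Dual R C) (c : C) (t : D ⊗[R] C) :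
    h (evalLeft c t) = (evalRight h t).1 c := by
  change h.ofConv (evalLeft c t) = LinearMap.applyₗ c (evalRight h t).1.ofConv
  induction t with
  | zero => simp
  | add x y hx hy => simp only [map_add, hx, hy]; rfl
  | tmul f x => rw [evalLeft_tmul, evalRight_tmul, map_smul, smul_eq_mul, mul_comm]; rfl

/-- `D` is dense in `C*` for the finite topology. Left coproperness is the case `D = C^□`. -/
def IsFinitelyDense (D : Submodule R (Dual R C)) : Prop :=
  ∀ (f : Dual R C) (F : Finset C), ∃ g ∈ D, ∀ c ∈ F, g c = f c

/-- Evaluation of the second leg of a tensor on the functionals in `D`. -/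
def evalOn (D : Submodule R (Dual R C)) : M ⊗[R] C →ₗ[R] (D →ₗ[R] M) :=
  (evalRight ∘ₗ D.subtype).flip

namespace IsFinitelyDense

variable {D : Submodule R (Dual R C)} (hD : IsFinitelyDense D)
include hD

lemma exists_evalRight_eq (g : Dual R C) (t : M ⊗[R] C) :
    ∃ f : D, evalRight f.1 t = evalRight g t := by
  classical
  obtain ⟨Q, rfl⟩ := TensorProduct.exists_finset t
  obtain ⟨f, hf, hfQ⟩ := hD g (Q.image Prod.snd)
  refine ⟨⟨f, hf⟩, ?_⟩
  simp only [map_sum, evalRight_tmul]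
  exact Finset.sum_congr rfl fun q hq => by rw [hfQ _ (Finset.mem_image_of_mem _ hq)]

variable (hC : IsLocallyProjective R C)
include hC

lemma exists_dual_basis (F : Finset C) :
    ∃ (E : Finset C) (f : C → D), ∀ c ∈ F, ∑ e ∈ E, (f e).1 c • e = c := by
  classical
  obtain ⟨h, hh⟩ := hC.exists_linearCombination_eq F
  choose g hgD hg using fun e : C => hD (WithConv.toConv (Finsupp.lapply e ∘ₗ h)) F
  refine ⟨F.biUnion fun c => (h c).support, fun e => ⟨g e, hgD e⟩, fun c hc => ?_⟩
  conv_rhs => rw [← hh c hc]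
  rw [Finsupp.linearCombination_apply, Finsupp.sum_of_support_subset (h c)
    (Finset.subset_biUnion_of_mem (fun c => (h c).support) hc) _ (by simp)]
  exact Finset.sum_congr rfl fun e _ => by rw [hg e c hc]; rfl

lemma exists_sum_evalRight_tmul_eq (t : M ⊗[R] C) :
    ∃ (E : Finset C) (f : C → D), ∑ e ∈ E, evalRight (f e).1 t ⊗ₜ[R] e = t := by
  classical
  obtain ⟨Q, rfl⟩ := TensorProduct.exists_finset t
  obtain ⟨E, f, hf⟩ := hD.exists_dual_basis hC (Q.image Prod.snd)
  refine ⟨E, f, ?_⟩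
  simp only [map_sum, evalRight_tmul, TensorProduct.sum_tmul]
  rw [Finset.sum_comm]
  refine Finset.sum_congr rfl fun q hq => ?_
  conv_rhs => rw [← hf q.2 (Finset.mem_image_of_mem _ hq)]
  simp only [TensorProduct.tmul_sum, TensorProduct.smul_tmul]

lemma evalOn_injective {M : Type*} [AddCommGroup M] [Module R M] :
    Function.Injective (evalOn D : M ⊗[R] C →ₗ[R] D →ₗ[R] M) := by
  refine (injective_iff_map_eq_zero _).2 fun t ht => ?_
  obtain ⟨E, f, hf⟩ := hD.exists_sum_evalRight_tmul_eq hC t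
  rw [← hf]
  refine Finset.sum_eq_zero fun e _ => ?_
  rw [show evalRight (f e).1 t = 0 from LinearMap.congr_fun ht (f e), TensorProduct.zero_tmul]

lemma tensor_ext {M : Type*} [AddCommGroup M] [Module R M] {s t : M ⊗[R] C}
    (h : ∀ f : D, evalRight f.1 s = evalRight f.1 t) : s = t :=
  hD.evalOn_injective hC (LinearMap.ext h)

lemma ext {c d : C} (h : ∀ f : D, f.1 c = f.1 d) : c = d :=
  (TensorProduct.lid R C).symm.injective <| hD.tensor_ext hC fun f =>
    congrArg (· • (1 : R)) (h f)

end IsFinitelyDense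

variable [Coalgebra R C]

lemma dual_mul_apply (f g : Dual R C) (c : C) :
    (f * g) c = f (evalRight g (Coalgebra.comul c)) := by
  change LinearMap.mul' R R (TensorProduct.map f.ofConv g.ofConv (Coalgebra.comul c)) =
    f.ofConv (evalRight g (Coalgebra.comul c))
  generalize Coalgebra.comul (R := R) c = y
  induction y with
  | zero => simp
  | add x y hx hy => simp only [map_add, hx, hy]
  | tmul u v => simp [mul_comm]

lemma evalRight_mul (f g : Dual R C) (t : M ⊗[R] C) :
    evalRight (f * g) t = evalRight f (LinearMap.lTensor M (evalRight g)
      (LinearMap.lTensor M Coalgebra.comul t)) := by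
  induction t with
  | zero => simp
  | add x y hx hy => simp only [map_add, hx, hy]
  | tmul m c =>
    rw [evalRight_tmul, dual_mul_apply, LinearMap.lTensor_tmul, LinearMap.lTensor_tmul,
      evalRight_tmul]

lemma dualEval_eq_evalRight (f : Dual R C) : dualEval f = evalRight f :=
  TensorProduct.ext' fun _ _ => rfl

lemma exists_mulBox_eq_evalRight (hC : IsLocallyProjective R C) (hcop : IsLeftCoproper R C)
    (g : boxDual R C) : ∃ t : boxDual R C ⊗[R] C, ∀ h : Dual R C, mulBox h g = evalRight h t := by
  obtain ⟨t, ht⟩ := g.2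
  simp only [dualEval_eq_evalRight] at ht
  obtain ⟨E, f, hf⟩ := IsFinitelyDense.exists_sum_evalRight_tmul_eq hcop hC t
  refine ⟨∑ e ∈ E, mulBox (f e).1 g ⊗ₜ e, fun h => Subtype.ext ?_⟩
  rw [coe_mulBox, ht, ← hf, ← (boxDual R C).subtype_apply]
  simp only [map_sum, evalRight_tmul, map_smul, Submodule.subtype_apply, coe_mulBox, ht]

lemma evalRight_comul_eq_evalLeft (hC : IsLocallyProjective R C) (hcop : IsLeftCoproper R C)
    {f : boxDual R C} {t : boxDual R C ⊗[R] C} (ht : ∀ h : Dual R C, mulBox h f = evalRight h t)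
    (c : C) : evalRight f.1 (Coalgebra.comul c) = evalLeft c t := by
  refine IsFinitelyDense.ext hcop hC fun h => ?_
  rw [← dual_mul_apply, ← coe_mulBox, ht, apply_evalLeft]

end Eval

/-! ### Extending the smash product to all functionals -/

section SmashDual

variable {R : Type u₁} {H : Type u₂} {A : Type u₃} {C : Type u₄} [CommRing R]
  [Ring H] [Bialgebra R H] [Ring A] [Algebra R A] [AddCommGroup C] [Module R C] [Coalgebra R C]

namespace RightRight

section

variable (S : RightRight R H A C)

/-- `(p ⊗ q) # g, a # h ↦ p a # (q h) ⋆ g`: the extension of `smashAux` to all `h ∈ C*`. -/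
def smashDualAux : (A ⊗[R] H) ⊗[R] boxDual R C →ₗ[R] A ⊗[R] Dual R C →ₗ[R] A ⊗[R] boxDual R C :=
  TensorProduct.map₂ (LinearMap.mul R A) (TensorProduct.lift S.twist) ∘ₗ
    (TensorProduct.assoc R A H (boxDual R C)).toLinearMap

/-- `(b # g)(a # h) = ∑ b₀ a # (b₁ h) ⋆ g`: the extension of the product of `A #ᵒᵖ C^□` to all
`h ∈ C*`. In particular `h` may be the counit, which need not lie in `C^□`. -/
def smashDual : A ⊗[R] boxDual R C →ₗ[R] A ⊗[R] Dual R C →ₗ[R] A ⊗[R] boxDual R C :=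
  S.smashDualAux ∘ₗ LinearMap.rTensor (boxDual R C) S.alg.coact.toLinearMap

end

variable {S : RightRight R H A C}

lemma smashDualAux_tmul (p : A) (q : H) (g : boxDual R C) (a : A) (h : Dual R C) :
    S.smashDualAux ((p ⊗ₜ q) ⊗ₜ g) (a ⊗ₜ h) = (p * a) ⊗ₜ mulBox (S.dualAct q h) g := rfl

lemma dualAct_one_left (f : Dual R C) : S.dualAct 1 f = f := by
  ext c
  exact congrArg f.ofConv (S.coalg.act_one c)

lemma dualAct_one_right (h : H) :
    S.dualAct h (1 : Dual R C) = Coalgebra.counit (R := R) h • (1 : Dual R C) := by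
  ext c
  change Coalgebra.counit (R := R) (S.coalg.act c h) =
    Coalgebra.counit (R := R) h * Coalgebra.counit (R := R) c
  rw [S.coalg.counit_act, mul_comm]

lemma smashDual_coe (s : A ⊗[R] boxDual R C) (a : A) (f : boxDual R C) :
    S.smashDual s (a ⊗ₜ f.1) = S.smashMul s (a ⊗ₜ f) :=
  LinearMap.congr_fun (TensorProduct.ext_threefold
    (g := S.smashDualAux.flip (a ⊗ₜ f.1)) (h := S.smashAux.flip (a ⊗ₜ f)) fun _ _ _ => rfl)
    (LinearMap.rTensor (boxDual R C) S.alg.coact.toLinearMap s)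

lemma smashMul_one_tmul (f g : boxDual R C) :
    S.smashMul (1 ⊗ₜ f) (1 ⊗ₜ g) = 1 ⊗ₜ mulBox g.1 f := by
  rw [smashMul_tmul, map_one, Algebra.TensorProduct.one_def, smashAux_tmul, mul_one]
  exact congrArg (fun h => (1 : A) ⊗ₜ mulBox h f) (dualAct_one_left g.1)

lemma rTensor_mulRight_smashDual (s : A ⊗[R] boxDual R C) (a : A) (h : Dual R C) :
    (LinearMap.mulRight R a).rTensor (boxDual R C) (S.smashDual s (1 ⊗ₜ h)) =
      S.smashDual s (a ⊗ₜ h) :=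
  LinearMap.congr_fun (TensorProduct.ext_threefold
    (g := (LinearMap.mulRight R a).rTensor (boxDual R C) ∘ₗ S.smashDualAux.flip (1 ⊗ₜ h))
    (h := S.smashDualAux.flip (a ⊗ₜ h)) fun p q g => by simp [smashDualAux_tmul])
    (LinearMap.rTensor (boxDual R C) S.alg.coact.toLinearMap s)

lemma smashDual_tmul_one (s : A ⊗[R] boxDual R C) (a : A) :
    S.smashDual s (a ⊗ₜ 1) = (LinearMap.mulRight R a).rTensor (boxDual R C) s := by
  let ε : A ⊗[R] H →ₗ[R] A :=
    (TensorProduct.rid R A).toLinearMap ∘ₗ LinearMap.lTensor A Coalgebra.counit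
  have hε : ε ∘ₗ S.alg.coact.toLinearMap = LinearMap.id := LinearMap.ext fun b =>
    (congrArg (TensorProduct.rid R A) (S.alg.counit b)).trans (by simp)
  have haux : S.smashDualAux.flip (a ⊗ₜ 1) =
      (LinearMap.mulRight R a).rTensor (boxDual R C) ∘ₗ ε.rTensor (boxDual R C) := by
    refine TensorProduct.ext_threefold fun p q g => ?_
    have hg : mulBox (1 : Dual R C) g = g := Subtype.ext (one_mul g.1)
    simp [smashDualAux_tmul, dualAct_one_right, hg, ε, TensorProduct.smul_tmul]
  calc S.smashDual s (a ⊗ₜ 1)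
    _ = (LinearMap.mulRight R a).rTensor (boxDual R C)
          (ε.rTensor (boxDual R C) (S.alg.coact.toLinearMap.rTensor (boxDual R C) s)) :=
      LinearMap.congr_fun haux _
    _ = (LinearMap.mulRight R a).rTensor (boxDual R C) s :=
      congrArg _ (by rw [← LinearMap.rTensor_comp_apply, hε, LinearMap.rTensor_id_apply])

lemma smashDual_rTensor_mulRight (s : A ⊗[R] boxDual R C) (a : A) (f : Dual R C) :
    S.smashDual ((LinearMap.mulRight R a).rTensor (boxDual R C) s) (1 ⊗ₜ f) =
      S.smashDual s (LinearMap.lTensor A (S.dualAct.flip f) (S.alg.coact a)) := by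
  have haux (z : A ⊗[R] H) : S.smashDualAux.flip (1 ⊗ₜ f) ∘ₗ
      (LinearMap.mulRight R z).rTensor (boxDual R C) =
        S.smashDualAux.flip (LinearMap.lTensor A (S.dualAct.flip f) z) := by
    refine TensorProduct.ext_threefold fun p q g => ?_
    induction z with
    | zero => simp
    | add x y hx hy => simp_all [mul_add, add_tmul]
    | tmul p' q' => simp [smashDualAux_tmul, dualAct_mul]
  have hcoact : S.alg.coact.toLinearMap ∘ₗ LinearMap.mulRight R a =
      LinearMap.mulRight R (S.alg.coact a) ∘ₗ S.alg.coact.toLinearMap :=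
    LinearMap.ext fun b => map_mul S.alg.coact b a
  rw [smashDual, LinearMap.comp_apply, ← LinearMap.rTensor_comp_apply, hcoact,
    LinearMap.rTensor_comp_apply]
  exact LinearMap.congr_fun (haux (S.alg.coact a)) _

lemma evalRight_map₂_act {M P : Type*} [AddCommMonoid M] [Module R M] [AddCommMonoid P]
    [Module R P] (β : M →ₗ[R] A →ₗ[R] P) (f : Dual R C) (x : M ⊗[R] C) (p : A) (q : H) :
    evalRight f (TensorProduct.map₂ β S.coalg.act x (p ⊗ₜ q)) =
      β (evalRight (S.dualAct q f) x) p := by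
  induction x with
  | zero => simp
  | add x y hx hy => simp only [map_add, LinearMap.add_apply, hx, hy]
  | tmul m c => simp [dualAct_apply]

lemma exists_evalRight_eq_smashDual (hC : IsLocallyProjective R C) (hcop : IsLeftCoproper R C)
    (s : A ⊗[R] boxDual R C) (a : A) : ∃ t : (A ⊗[R] boxDual R C) ⊗[R] C,
      ∀ h : Dual R C, evalRight h t = S.smashDual s (a ⊗ₜ h) := by
  induction s with
  | zero => exact ⟨0, by simp⟩
  | add x y hx hy =>
    obtain ⟨t, ht⟩ := hx
    obtain ⟨u, hu⟩ := hy
    exact ⟨t + u, fun h => by simp only [map_add, LinearMap.add_apply, ht, hu]⟩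
  | tmul b g =>
    obtain ⟨t, ht⟩ := exists_mulBox_eq_evalRight hC hcop g
    let β : boxDual R C →ₗ[R] A →ₗ[R] A ⊗[R] boxDual R C :=
      (TensorProduct.mk R A (boxDual R C) ∘ₗ LinearMap.mulRight R a).flip
    refine ⟨TensorProduct.map₂ β S.coalg.act t (S.alg.coact b), fun h => ?_⟩
    change _ = S.smashDualAux (S.alg.coact b ⊗ₜ g) (a ⊗ₜ h)
    generalize S.alg.coact b = y
    induction y with
    | zero => simp
    | add x y hx hy => simp only [add_tmul, map_add, LinearMap.add_apply, hx, hy]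
    | tmul p q =>
      rw [evalRight_map₂_act, smashDualAux_tmul, ht]
      rfl

end RightRight

end SmashDual

/-! ### Doi-Koppinen modules as modules over the smash product -/

section ToOpSmash

variable {R : Type u₁} {H : Type u₂} {A : Type u₃} {C : Type u₄} [CommRing R]
  [Ring H] [Bialgebra R H] [Ring A] [Algebra R A] [AddCommGroup C] [Module R C] [Coalgebra R C]
  {S : RightRight R H A C}

namespace RMod

/-- The action of `A #ᵒᵖ C^□`, as a bilinear map on `A ⊗ C^□`. -/
def smashAct (N : RMod.{u₁, max u₁ u₃ u₄, w} R S.OpSmash) :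
    N.carrier →ₗ[R] A ⊗[R] boxDual R C →ₗ[R] N.carrier := N.act

lemma smashAct_smashMul {N : RMod.{u₁, max u₁ u₃ u₄, w} R S.OpSmash} (n : N.carrier)
    (s t : A ⊗[R] boxDual R C) :
    N.smashAct n (S.smashMul s t) = N.smashAct (N.smashAct n s) t :=
  N.act_mul n s t

end RMod

namespace RRModule

variable (M : RRModule.{u₁, u₂, u₃, u₄, w} S)

lemma evalRight_one_coact (m : M.carrier) : evalRight (1 : Dual R C) (M.coact m) = m := by
  have h := congrArg (TensorProduct.rid R M.carrier) (M.counit m)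
  rw [TensorProduct.rid_tmul, one_smul] at h
  exact h

lemma smashAct_toOpSmash_tmul (m : M.carrier) (a : A) (f : boxDual R C) :
    RMod.smashAct ((toOpSmash S).obj M) m (a ⊗ₜ f) = M.act (evalRight f.1 (M.coact m)) a := by
  suffices M.evalDual (S.smashToLeftDual (a ⊗ₜ f)) = M.act.flip a ∘ₗ evalRight f.1 from
    LinearMap.congr_fun this (M.coact m)
  exact TensorProduct.ext' fun n c => by
    simp [evalDual_tmul, RightRight.smashToLeftDual_tmul]

lemma isUnital_toOpSmash_obj (hcop : IsLeftCoproper R C) :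
    RMod.IsUnital R S.OpSmash ((toOpSmash S).obj M) := by
  refine Submodule.eq_top_iff'.2 fun m => Submodule.subset_span ?_
  obtain ⟨f, hf⟩ := IsFinitelyDense.exists_evalRight_eq hcop 1 (M.coact m)
  refine ⟨m, (1 ⊗ₜ f : A ⊗[R] boxDual R C), (M.smashAct_toOpSmash_tmul m 1 f).trans ?_⟩
  exact (congrArg (M.act · 1) (hf.trans (M.evalRight_one_coact m))).trans (M.act_one m)

variable {M} {N : RRModule.{u₁, u₂, u₃, u₄, w} S} (hC : IsLocallyProjective R C)
  (hcop : IsLeftCoproper R C) {φ : M.carrier →ₗ[R] N.carrier}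
  (hφ : ∀ m s, φ (RMod.smashAct ((toOpSmash S).obj M) m s) =
    RMod.smashAct ((toOpSmash S).obj N) (φ m) s)
include hC hcop hφ

lemma rTensor_coact_of_map_smashAct (m : M.carrier) (a : A) :
    LinearMap.rTensor C (φ ∘ₗ M.act.flip a) (M.coact m) =
      LinearMap.rTensor C (N.act.flip a) (N.coact (φ m)) := by
  refine IsFinitelyDense.tensor_ext hcop hC fun f => ?_
  rw [evalRight_rTensor, evalRight_rTensor]
  exact (congrArg φ (M.smashAct_toOpSmash_tmul m a f)).symm.trans
    ((hφ m (a ⊗ₜ f)).trans (N.smashAct_toOpSmash_tmul (φ m) a f))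

lemma map_act_of_map_smashAct (m : M.carrier) (a : A) : φ (M.act m a) = N.act (φ m) a := by
  have h := congrArg (evalRight (1 : Dual R C)) (rTensor_coact_of_map_smashAct hC hcop hφ m a)
  rwa [evalRight_rTensor, evalRight_rTensor, M.evalRight_one_coact, N.evalRight_one_coact] at h

lemma map_coact_of_map_smashAct (m : M.carrier) :
    N.coact (φ m) = LinearMap.rTensor C φ (M.coact m) := by
  have hM : M.act.flip 1 = LinearMap.id := LinearMap.ext M.act_one
  have hN : N.act.flip 1 = LinearMap.id := LinearMap.ext N.act_one
  have h := rTensor_coact_of_map_smashAct hC hcop hφ m 1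
  rw [hM, hN, LinearMap.rTensor_id, LinearMap.comp_id] at h
  exact h.symm

end RRModule

instance : (toOpSmash.{u₁, u₂, u₃, u₄, w} S).Faithful where
  map_injective h := RRModule.Hom.ext (congrArg RMod.Hom.toLin h)

variable (hC : IsLocallyProjective R C) (hcop : IsLeftCoproper R C)
include hC hcop

lemma toOpSmash_full : (toOpSmash.{u₁, u₂, u₃, u₄, w} S).Full where
  map_surjective φ :=
    ⟨⟨RMod.Hom.toLin φ, RRModule.map_act_of_map_smashAct hC hcop (RMod.Hom.map_act φ),
      RRModule.map_coact_of_map_smashAct hC hcop (RMod.Hom.map_act φ)⟩, rfl⟩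

lemma toOpSmash_obj_injective :
    Function.Injective (toOpSmash.{u₁, u₂, u₃, u₄, w} S).obj := by
  intro M M' h
  obtain ⟨M, α, hα₁, hα₂, γ, hγ₁, hγ₂, hγ₃⟩ := M
  obtain ⟨M', β, hβ₁, hβ₂, δ, hδ₁, hδ₂, hδ₃⟩ := M'
  injection h with hM hadd hmod hact
  subst hM
  obtain rfl := eq_of_heq hadd
  obtain rfl := eq_of_heq hmod
  have hid := LinearMap.congr_fun₂ (eq_of_heq hact)
  have hαβ : α = β := LinearMap.ext₂ <| RRModule.map_act_of_map_smashAct (φ := LinearMap.id)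
    (M := ⟨M, α, hα₁, hα₂, γ, hγ₁, hγ₂, hγ₃⟩) (N := ⟨M, β, hβ₁, hβ₂, δ, hδ₁, hδ₂, hδ₃⟩)
    hC hcop hid
  have hγδ : δ = LinearMap.rTensor C LinearMap.id ∘ₗ γ :=
    LinearMap.ext <| RRModule.map_coact_of_map_smashAct (φ := LinearMap.id)
      (M := ⟨M, α, hα₁, hα₂, γ, hγ₁, hγ₂, hγ₃⟩) (N := ⟨M, β, hβ₁, hβ₂, δ, hδ₁, hδ₂, hδ₃⟩)
      hC hcop hid
  rw [LinearMap.rTensor_id, LinearMap.id_comp] at hγδ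
  simp only [hαβ, hγδ]

end ToOpSmash

/-! ### Reconstructing a Doi-Koppinen module from a unital module -/

section Reconstruction

variable {R : Type u₁} {H : Type u₂} {A : Type u₃} {C : Type u₄} [CommRing R]
  [Ring H] [Bialgebra R H] [Ring A] [Algebra R A] [AddCommGroup C] [Module R C] [Coalgebra R C]
  {S : RightRight R H A C}

namespace RMod

variable {N : RMod.{u₁, max u₁ u₃ u₄, w} R S.OpSmash} (hC : IsLocallyProjective R C)
  (hcop : IsLeftCoproper R C) (hN : RMod.IsUnital R S.OpSmash N)
include hC hcop hN

lemma IsUnital.curry_smashAct_mem_range (n : N.carrier) (a : A) :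
    TensorProduct.curry (N.smashAct n) a ∈ LinearMap.range (evalOn (boxDual R C)) := by
  let B := (TensorProduct.lcurry (RingHom.id R) A (boxDual R C) N.carrier ∘ₗ N.smashAct).flip a
  refine hN.mem (p := (LinearMap.range (evalOn (boxDual R C))).comap B)
    (fun n (s : A ⊗[R] boxDual R C) => ?_) n
  obtain ⟨t, ht⟩ := S.exists_evalRight_eq_smashDual hC hcop s a
  refine ⟨LinearMap.rTensor C (N.smashAct n) t, LinearMap.ext fun f => ?_⟩
  calc evalRight f.1 (LinearMap.rTensor C (N.smashAct n) t)
    _ = N.smashAct n (S.smashDual s (a ⊗ₜ f.1)) := by rw [evalRight_rTensor, ht]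
    _ = N.smashAct (N.smashAct n s) (a ⊗ₜ f) := by
      rw [RightRight.smashDual_coe, smashAct_smashMul]

/-- `(n, a) ↦ ∑ n₀ a ⊗ n₁` on a unital `A #ᵒᵖ C^□`-module, characterized by its values under
`C^□`. -/
def coactAct : N.carrier →ₗ[R] A →ₗ[R] N.carrier ⊗[R] C :=
  (TensorProduct.lcurry (RingHom.id R) A (boxDual R C) N.carrier ∘ₗ N.smashAct).codRestrict₂
    (evalOn (boxDual R C)) (IsFinitelyDense.evalOn_injective hcop hC)
    (IsUnital.curry_smashAct_mem_range hC hcop hN)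

lemma evalRight_coactAct (n : N.carrier) (a : A) (f : boxDual R C) :
    evalRight f.1 (coactAct hC hcop hN n a) = N.smashAct n (a ⊗ₜ f) :=
  LinearMap.congr_fun (LinearMap.codRestrict₂_apply _ (evalOn (boxDual R C))
    (IsFinitelyDense.evalOn_injective hcop hC)
    (IsUnital.curry_smashAct_mem_range hC hcop hN) n a) f

lemma evalRight_coactAct_smashAct (n : N.carrier) (s : A ⊗[R] boxDual R C) (a : A)
    (h : Dual R C) : evalRight h (coactAct hC hcop hN (N.smashAct n s) a) =
      N.smashAct n (S.smashDual s (a ⊗ₜ h)) := by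
  obtain ⟨t, ht⟩ := S.exists_evalRight_eq_smashDual hC hcop s a
  suffices coactAct hC hcop hN (N.smashAct n s) a = LinearMap.rTensor C (N.smashAct n) t by
    rw [this, evalRight_rTensor, ht]
  refine IsFinitelyDense.tensor_ext hcop hC fun f => ?_
  rw [evalRight_coactAct, evalRight_rTensor, ht, RightRight.smashDual_coe, smashAct_smashMul]

/-- The `A`-action on a unital `A #ᵒᵖ C^□`-module. -/
def algAct : N.carrier →ₗ[R] A →ₗ[R] N.carrier :=
  (coactAct hC hcop hN).compr₂ (evalRight (1 : Dual R C))

lemma algAct_smashAct (n : N.carrier) (s : A ⊗[R] boxDual R C) (a : A) :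
    algAct hC hcop hN (N.smashAct n s) a =
      N.smashAct n ((LinearMap.mulRight R a).rTensor (boxDual R C) s) := by
  rw [← S.smashDual_tmul_one]
  exact evalRight_coactAct_smashAct hC hcop hN n s a 1

lemma algAct_one (n : N.carrier) : algAct hC hcop hN n 1 = n := by
  suffices (algAct hC hcop hN).flip 1 = LinearMap.id from LinearMap.congr_fun this n
  refine hN.linearMap_ext fun n (s : A ⊗[R] boxDual R C) => ?_
  refine (algAct_smashAct hC hcop hN n s 1).trans ?_
  rw [LinearMap.mulRight_one, LinearMap.rTensor_id_apply]
  rfl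

lemma algAct_mul (n : N.carrier) (a b : A) : algAct hC hcop hN n (a * b) =
    algAct hC hcop hN (algAct hC hcop hN n a) b := by
  suffices (algAct hC hcop hN).flip (a * b) =
      (algAct hC hcop hN).flip b ∘ₗ (algAct hC hcop hN).flip a from LinearMap.congr_fun this n
  refine hN.linearMap_ext fun n (s : A ⊗[R] boxDual R C) => ?_
  change algAct hC hcop hN (N.smashAct n s) (a * b) =
    algAct hC hcop hN (algAct hC hcop hN (N.smashAct n s) a) b
  simp only [algAct_smashAct, LinearMap.mulRight_mul, LinearMap.rTensor_comp_apply]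

/-- The `C`-coaction on a unital `A #ᵒᵖ C^□`-module. -/
def boxCoact : N.carrier →ₗ[R] N.carrier ⊗[R] C := (coactAct hC hcop hN).flip 1

lemma evalRight_boxCoact (n : N.carrier) (f : boxDual R C) :
    evalRight f.1 (boxCoact hC hcop hN n) = N.smashAct n (1 ⊗ₜ f) :=
  evalRight_coactAct hC hcop hN n 1 f

lemma evalRight_boxCoact_smashAct (n : N.carrier) (s : A ⊗[R] boxDual R C) (h : Dual R C) :
    evalRight h (boxCoact hC hcop hN (N.smashAct n s)) =
      N.smashAct n (S.smashDual s (1 ⊗ₜ h)) :=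
  evalRight_coactAct_smashAct hC hcop hN n s 1 h

lemma boxCoact_coassoc (n : N.carrier) :
    TensorProduct.assoc R N.carrier C C (LinearMap.rTensor C (boxCoact hC hcop hN)
      (boxCoact hC hcop hN n)) =
    LinearMap.lTensor N.carrier Coalgebra.comul (boxCoact hC hcop hN n) := by
  rw [← LinearEquiv.eq_symm_apply]
  refine IsFinitelyDense.tensor_ext hcop hC fun g =>
    IsFinitelyDense.tensor_ext hcop hC fun f => ?_
  rw [evalRight_evalRight_assoc_symm, ← evalRight_mul, evalRight_rTensor, evalRight_boxCoact,
    evalRight_boxCoact, ← smashAct_smashMul, RightRight.smashMul_one_tmul]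
  exact (evalRight_boxCoact hC hcop hN n (mulBox f.1 g)).symm

lemma boxCoact_counit (n : N.carrier) :
    LinearMap.lTensor N.carrier Coalgebra.counit (boxCoact hC hcop hN n) = n ⊗ₜ[R] (1 : R) := by
  apply (TensorProduct.rid R N.carrier).injective
  rw [TensorProduct.rid_tmul, one_smul]
  exact algAct_one hC hcop hN n

lemma boxCoact_algAct (n : N.carrier) (a : A) :
    boxCoact hC hcop hN (algAct hC hcop hN n a) =
      TensorProduct.map₂ (algAct hC hcop hN) S.coalg.act (boxCoact hC hcop hN n)
        (S.alg.coact a) := by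
  let Φ := (TensorProduct.map₂ (algAct hC hcop hN) S.coalg.act).flip (S.alg.coact a)
  suffices boxCoact hC hcop hN ∘ₗ (algAct hC hcop hN).flip a = Φ ∘ₗ boxCoact hC hcop hN from
    LinearMap.congr_fun this n
  refine hN.linearMap_ext fun n (s : A ⊗[R] boxDual R C) =>
    IsFinitelyDense.tensor_ext hcop hC fun f => ?_
  change evalRight f.1 (boxCoact hC hcop hN (algAct hC hcop hN (N.smashAct n s) a)) =
    evalRight f.1 (TensorProduct.map₂ (algAct hC hcop hN) S.coalg.act
      (boxCoact hC hcop hN (N.smashAct n s)) (S.alg.coact a))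
  rw [algAct_smashAct, evalRight_boxCoact_smashAct, RightRight.smashDual_rTensor_mulRight]
  generalize S.alg.coact a = y
  induction y with
  | zero => simp
  | add x y hx hy => simp only [map_add, hx, hy]
  | tmul p q =>
    rw [RightRight.evalRight_map₂_act, evalRight_boxCoact_smashAct, algAct_smashAct,
      RightRight.rTensor_mulRight_smashDual, LinearMap.lTensor_tmul, LinearMap.flip_apply]

/-- The Doi-Koppinen module of a unital `A #ᵒᵖ C^□`-module. -/
def toRRModule : RRModule.{u₁, u₂, u₃, u₄, w} S where
  carrier := N.carrier
  act := algAct hC hcop hN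
  act_one := algAct_one hC hcop hN
  act_mul := algAct_mul hC hcop hN
  coact := boxCoact hC hcop hN
  coassoc := boxCoact_coassoc hC hcop hN
  counit := boxCoact_counit hC hcop hN
  compat := boxCoact_algAct hC hcop hN

lemma smashAct_toOpSmash_toRRModule :
    ((toOpSmash S).obj (toRRModule hC hcop hN)).smashAct = N.smashAct := by
  refine LinearMap.ext fun (n : N.carrier) => TensorProduct.ext' fun a f => ?_
  refine ((toRRModule hC hcop hN).smashAct_toOpSmash_tmul n a f).trans ?_
  change algAct hC hcop hN (evalRight f.1 (boxCoact hC hcop hN n)) a = _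
  rw [evalRight_boxCoact, algAct_smashAct, LinearMap.rTensor_tmul, LinearMap.mulRight_apply,
    one_mul]
  rfl

end RMod

lemma RMod.mk_eq_mk {T : Type u₂} [NonUnitalRing T] [Module R T] {M : Type w} [AddCommGroup M]
    [Module R M] {α β : M →ₗ[R] T →ₗ[R] M} (h : α = β) (hα hβ) :
    RMod.mk (R := R) (T := T) M α hα = RMod.mk M β hβ := by
  subst h; rfl

variable (hC : IsLocallyProjective R C) (hcop : IsLeftCoproper R C)
include hC hcop

lemma toOpSmash_obj_toRRModule {N : RMod.{u₁, max u₁ u₃ u₄, w} R S.OpSmash}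
    (hN : RMod.IsUnital R S.OpSmash N) :
    (toOpSmash S).obj (RMod.toRRModule hC hcop hN) = N := by
  have h := RMod.smashAct_toOpSmash_toRRModule hC hcop hN
  cases N
  exact RMod.mk_eq_mk h _ _

lemma toOpSmash_isIsoOnto :
    IsIsoOnto (toOpSmash.{u₁, u₂, u₃, u₄, w} S) (RMod.IsUnital R S.OpSmash) where
  full := toOpSmash_full hC hcop
  faithful := inferInstance
  injective := toOpSmash_obj_injective hC hcop
  mem_iff N := by
    constructor
    · exact fun hN => ⟨_, toOpSmash_obj_toRRModule hC hcop hN⟩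
    · rintro ⟨M, rfl⟩
      exact M.isUnital_toOpSmash_obj hcop

end Reconstruction

/-! ### The morphism from the smash product to the rational dual of the coring -/

section BoxLeftDual

variable {R : Type u₁} {H : Type u₂} {A : Type u₃} {C : Type u₄} [CommRing R]
  [Ring H] [Bialgebra R H] [Ring A] [Algebra R A] [AddCommGroup C] [Module R C] [Coalgebra R C]
  {S : RightRight R H A C}

namespace RightRight

lemma LeftDual.apply_tmul (g : S.LeftDual) (a : A) (c : C) : g (a ⊗ₜ c) = a * g (1 ⊗ₜ c) := by
  rw [← g.map_smul_left, TensorProduct.smul_tmul', smul_eq_mul, mul_one]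

lemma contract_smashToLeftDual (a : A) (f : boxDual R C) (c : C) :
    contract (S.smashToLeftDual (a ⊗ₜ f)) (S.coringComul (1 ⊗ₜ c)) =
      S.coringAct (1 ⊗ₜ evalRight f.1 (Coalgebra.comul c)) a := by
  rw [coringComul_one_tmul]
  generalize Coalgebra.comul (R := R) c = s
  induction s with
  | zero => simp
  | add x y hx hy => simp only [map_add, hx, hy, tmul_add, LinearMap.add_apply]
  | tmul x y => simp [smashToLeftDual_tmul]

variable (S) in
/-- `(p ⊗ q) ⊗ (f ⊗ x) ↦ (p # f) ⊗ (1 ⊗ x q)`. Applied to the coaction of `a` and to a tensor that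
witnesses the rationality of `f ∈ C^□`, it witnesses the rationality of `a # f` in `*𝒞`. -/
def smashRationalTensor :
    A ⊗[R] H →ₗ[R] boxDual R C ⊗[R] C →ₗ[R] S.LeftDual ⊗[R] (A ⊗[R] C) :=
  TensorProduct.map₂ (TensorProduct.curry S.smashToLeftDual)
    (S.coalg.act.flip.compr₂ (TensorProduct.mk R A C 1))

lemma leftDualEval_smashRationalTensor (g : S.LeftDual) (y : A ⊗[R] H)
    (t : boxDual R C ⊗[R] C) (c : C) :
    leftDualEval g (S.smashRationalTensor y t) (1 ⊗ₜ c) =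
      g (TensorProduct.map₂ (LinearMap.mul R A) S.coalg.act (1 ⊗ₜ evalLeft c t) y) := by
  induction y with
  | zero => simp
  | add x y hx hy => simp only [map_add, LinearMap.add_apply, LeftDual.add_apply, hx, hy]
  | tmul p q =>
    induction t with
    | zero => simp
    | add x y hx hy =>
      simp only [map_add, tmul_add, LinearMap.add_apply, LeftDual.add_apply, hx, hy]
    | tmul f x =>
      simp [smashRationalTensor, smashToLeftDual_tmul, evalLeft_tmul, LeftDual.apply_tmul g p,
        LeftDual.map_smul_R]

lemma exists_finset_apply_eq (d : A ⊗[R] C) : ∃ F : Finset C, ∀ g g' : S.LeftDual,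
    (∀ c ∈ F, g (1 ⊗ₜ c) = g' (1 ⊗ₜ c)) → g d = g' d := by
  classical
  obtain ⟨P, rfl⟩ := TensorProduct.exists_finset d
  refine ⟨P.image Prod.snd, fun g g' h => ?_⟩
  rw [map_sum, map_sum]
  refine Finset.sum_congr rfl fun p hp => ?_
  rw [g.apply_tmul, g'.apply_tmul, h _ (Finset.mem_image_of_mem _ hp)]

lemma exists_finset_leftDualEval_eq (t : S.LeftDual ⊗[R] (A ⊗[R] C)) :
    ∃ F : Finset C, ∀ g g' : S.LeftDual, (∀ c ∈ F, g (1 ⊗ₜ c) = g' (1 ⊗ₜ c)) →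
      leftDualEval g t = leftDualEval g' t := by
  classical
  induction t with
  | zero => exact ⟨∅, by simp⟩
  | add x y hx hy =>
    obtain ⟨F, hF⟩ := hx
    obtain ⟨F', hF'⟩ := hy
    refine ⟨F ∪ F', fun g g' h => ?_⟩
    rw [map_add, map_add, hF g g' fun c hc => h c (Finset.mem_union_left _ hc),
      hF' g g' fun c hc => h c (Finset.mem_union_right _ hc)]
  | tmul f d =>
    obtain ⟨F, hF⟩ := S.exists_finset_apply_eq d
    refine ⟨F, fun g g' h => DFunLike.ext _ _ fun x => ?_⟩
    rw [leftDualEval_tmul, leftDualEval_tmul, hF g g' h]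

variable (hC : IsLocallyProjective R C) (hcop : IsLeftCoproper R C)
include hC hcop

lemma smashToLeftDual_tmul_mem (a : A) (f : boxDual R C) :
    S.smashToLeftDual (a ⊗ₜ f) ∈ S.boxLeftDual := by
  obtain ⟨t, ht⟩ := exists_mulBox_eq_evalRight hC hcop f
  refine ⟨S.smashRationalTensor (S.alg.coact a) t, fun g => LeftDual.ext fun c => ?_⟩
  rw [LeftDual.mul_apply, contract_smashToLeftDual, evalRight_comul_eq_evalLeft hC hcop ht,
    coringAct_apply, leftDualEval_smashRationalTensor]

lemma smashToLeftDual_mem (s : A ⊗[R] boxDual R C) : S.smashToLeftDual s ∈ S.boxLeftDual := by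
  induction s with
  | zero => rw [map_zero]; exact zero_mem _
  | add x y hx hy => rw [map_add]; exact add_mem hx hy
  | tmul a f => exact smashToLeftDual_tmul_mem hC hcop a f

lemma exists_smashToLeftDual_apply_eq (g : S.LeftDual) (F : Finset C) :
    ∃ s : A ⊗[R] boxDual R C, ∀ c ∈ F, g (1 ⊗ₜ c) = S.smashToLeftDual s (1 ⊗ₜ c) := by
  obtain ⟨E, f, hf⟩ := IsFinitelyDense.exists_dual_basis hcop hC F
  refine ⟨∑ e ∈ E, g (1 ⊗ₜ e) ⊗ₜ f e, fun c hc => ?_⟩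
  calc g (1 ⊗ₜ c)
    _ = ∑ e ∈ E, S.smashToLeftDual (g (1 ⊗ₜ e) ⊗ₜ f e) (1 ⊗ₜ c) := by
      conv_lhs => rw [← hf c hc, TensorProduct.tmul_sum, map_sum]
      refine Finset.sum_congr rfl fun e _ => ?_
      rw [smashToLeftDual_tmul, one_mul, TensorProduct.tmul_smul, LeftDual.map_smul_R]
    _ = S.smashToLeftDual (∑ e ∈ E, g (1 ⊗ₜ e) ⊗ₜ f e) (1 ⊗ₜ c) := by
      rw [map_sum]
      exact (LinearMap.sum_apply (R := A) (M := A ⊗[R] C) (M₂ := A) E _ (1 ⊗ₜ c)).symm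

lemma exists_mul_eq_mul_smashToLeftDual {f : S.LeftDual} (hf : f ∈ S.boxLeftDual)
    (g : S.LeftDual) : ∃ s : A ⊗[R] boxDual R C, f * g = f * S.smashToLeftDual s := by
  obtain ⟨t, ht⟩ := hf
  obtain ⟨F, hF⟩ := exists_finset_leftDualEval_eq t
  obtain ⟨s, hs⟩ := exists_smashToLeftDual_apply_eq hC hcop g F
  exact ⟨s, by rw [ht, ht, hF _ _ hs]⟩

/-- The morphism `A #ᵒᵖ C^□ → ^□𝒞` through which `smashToLeftDual` factors. -/
def smashToBox : S.OpSmash →ₙₐ[R] S.boxLeftDual where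
  toFun s := ⟨S.smashToLeftDual s, smashToLeftDual_mem hC hcop s⟩
  map_zero' := Subtype.ext (map_zero S.smashToLeftDual)
  map_add' s t := Subtype.ext (map_add S.smashToLeftDual s t)
  map_smul' r s := Subtype.ext (map_smul S.smashToLeftDual r s)
  map_mul' s t := Subtype.ext (smashToLeftDual_mul s t)

lemma exists_mul_eq_mul_smashToBox (f g : S.boxLeftDual) :
    ∃ s : S.OpSmash, f * g = f * smashToBox hC hcop s := by
  obtain ⟨s, hs⟩ := exists_mul_eq_mul_smashToLeftDual hC hcop f.2 g.1
  exact ⟨s, Subtype.ext hs⟩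

end RightRight

variable (hC : IsLocallyProjective R C) (hcop : IsLeftCoproper R C)
include hC hcop

lemma toBoxDual_isIsoOnto :
    IsIsoOnto (toBoxDual.{u₁, u₂, u₃, u₄, w} S) (RMod.IsUnital R S.boxLeftDual) := by
  let θ : S.OpSmash →ₙₐ[R] S.boxLeftDual := RightRight.smashToBox hC hcop
  have hθ := RightRight.exists_mul_eq_mul_smashToBox (S := S) hC hcop
  have hcomp : IsIsoOnto (toBoxDual.{u₁, u₂, u₃, u₄, w} S ⋙ RMod.restrictScalars θ)
      (RMod.IsUnital R S.OpSmash) := toOpSmash_isIsoOnto hC hcop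
  refine hcomp.of_comp (fun M => ?_) (fun N hN => hN.restrictScalars_obj hθ)
    fun N N' hN _ h => hN.eq_of_restrictScalars_obj_eq hθ h
  exact RMod.IsUnital.of_restrictScalars_obj (θ := θ) (M.isUnital_toOpSmash_obj hcop)

end BoxLeftDual

/-! ### Left-right structures -/

section LeftRightOp

universe v

lemma IsIsoOnto.top_of_bijective {𝒳 𝒴 : Type*} [Category 𝒳] [Category 𝒴] (F : 𝒳 ⥤ 𝒴) [F.Full]
    [F.Faithful] (hF : Function.Bijective F.obj) : IsIsoOnto F ⊤ where
  full := inferInstance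
  faithful := inferInstance
  injective := hF.1
  mem_iff Y := ⟨fun _ => hF.2 Y, fun _ => trivial⟩

section Op

variable {R : Type u₁} [CommRing R] {T : Type u₂} [NonUnitalRing T] [Module R T]

/-- A left `Tᵒᵖ`-module is a right `T`-module. -/
def LMod.unop (N : LMod.{u₁, u₂, w} R Tᵐᵒᵖ) : RMod.{u₁, u₂, w} R T where
  carrier := N.carrier
  act := (N.act ∘ₗ (MulOpposite.opLinearEquiv R).toLinearMap).flip
  act_mul m s t := N.mul_act (MulOpposite.op t) (MulOpposite.op s) m

instance : (RMod.opFunctor.{u₁, u₂, w} R T).Full where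
  map_surjective φ :=
    ⟨⟨LMod.Hom.toLin φ, fun m t => LMod.Hom.map_act φ (MulOpposite.op t) m⟩, rfl⟩

instance : (RMod.opFunctor.{u₁, u₂, w} R T).Faithful where
  map_injective h := RMod.Hom.ext (congrArg LMod.Hom.toLin h)

lemma RMod.opFunctor_isIsoOnto : IsIsoOnto (RMod.opFunctor.{u₁, u₂, w} R T) ⊤ :=
  .top_of_bijective _
    (Function.bijective_iff_has_inverse.2 ⟨LMod.unop, fun _ => rfl, fun _ => rfl⟩)

lemma RMod.isUnital_opFunctor_obj_iff (M : RMod.{u₁, u₂, w} R T) :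
    LMod.IsUnital R Tᵐᵒᵖ ((RMod.opFunctor R T).obj M) ↔ RMod.IsUnital R T M := by
  have h : {x | ∃ t m, ((RMod.opFunctor R T).obj M).act t m = x} =
      {x | ∃ m t, M.act m t = x} :=
    Set.ext fun _ => ⟨fun ⟨t, m, e⟩ => ⟨m, t.unop, e⟩, fun ⟨m, t, e⟩ => ⟨.op t, m, e⟩⟩
  exact Eq.to_iff (congrArg (fun s => Submodule.span R s = ⊤) h)

end Op

variable {R : Type u₁} {H : Type u₂} {A : Type u₃} {C : Type u₄} [CommRing R]
  [Ring H] [Bialgebra R H] [Ring A] [Algebra R A] [AddCommGroup C] [Module R C] [Coalgebra R C]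
  (S : LeftRight R H A C)

variable {S} in
lemma LeftRight.map₂_op_act_opMap {M : Type*} [AddCommMonoid M] [Module R M]
    (β : M →ₗ[R] Aᵐᵒᵖ →ₗ[R] M) (y : M ⊗[R] C) (x : A ⊗[R] H) :
    TensorProduct.map₂ β S.op.coalg.act y (opMap R A H x) =
      TensorProduct.map₂ (β.flip ∘ₗ (MulOpposite.opLinearEquiv R).toLinearMap) S.coalg.act x y := by
  induction x with
  | zero => simp
  | add x x' hx hx' => simp only [map_add, hx, hx', LinearMap.add_apply]
  | tmul a h =>
    induction y with
    | zero => simp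
    | add y y' hy hy' => simp only [map_add, hy, hy', LinearMap.add_apply]
    | tmul m c => simp [LeftRight.op, LeftModuleCoalgebra.op]

variable {S} in
/-- A right-right Doi-Koppinen module over `(Hᵒᵖ, Aᵒᵖ, C)` is a left-right one over
`(H, A, C)`. -/
def RRModule.unop (M : RRModule.{u₁, u₂, u₃, u₄, w} S.op) : LRModule.{u₁, u₂, u₃, u₄, w} S where
  carrier := M.carrier
  act := M.act.flip ∘ₗ (MulOpposite.opLinearEquiv R).toLinearMap
  one_act m := M.act_one m
  mul_act a b m := M.act_mul m (MulOpposite.op b) (MulOpposite.op a)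
  coact := M.coact
  coassoc := M.coassoc
  counit := M.counit
  compat a m := (M.compat m (MulOpposite.op a)).trans
    (LeftRight.map₂_op_act_opMap M.act (M.coact m) (S.alg.coact a))

instance : (LRModule.opFunctor.{u₁, u₂, u₃, u₄, w} S).Full where
  map_surjective φ := ⟨⟨RRModule.Hom.toLin φ,
    fun a m => RRModule.Hom.map_act φ m (MulOpposite.op a), RRModule.Hom.map_coact φ⟩, rfl⟩

instance : (LRModule.opFunctor.{u₁, u₂, u₃, u₄, w} S).Faithful where
  map_injective h := LRModule.Hom.ext (congrArg RRModule.Hom.toLin h)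

lemma LRModule.opFunctor_isIsoOnto : IsIsoOnto (LRModule.opFunctor.{u₁, u₂, u₃, u₄, w} S) ⊤ :=
  .top_of_bijective _
    (Function.bijective_iff_has_inverse.2 ⟨RRModule.unop, fun _ => rfl, fun _ => rfl⟩)

variable {S} in
lemma IsIsoOnto.opFunctor_comp_comp_opFunctor {T : Type v} [NonUnitalRing T] [Module R T]
    {F : RRModule.{u₁, u₂, u₃, u₄, w} S.op ⥤ RMod.{u₁, v, w} R T}
    (hF : IsIsoOnto F (RMod.IsUnital R T)) :
    IsIsoOnto (LRModule.opFunctor S ⋙ F ⋙ RMod.opFunctor R T) (LMod.IsUnital R Tᵐᵒᵖ) := by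
  have hFop : IsIsoOnto (F ⋙ RMod.opFunctor R T) (LMod.IsUnital R Tᵐᵒᵖ) :=
    hF.comp RMod.opFunctor_isIsoOnto le_top RMod.isUnital_opFunctor_obj_iff
  refine (LRModule.opFunctor_isIsoOnto S).comp hFop le_rfl fun M => ?_
  exact iff_of_true ((hFop.mem_iff _).2 ⟨M, rfl⟩) trivial

variable (hC : IsLocallyProjective R C) (hcop : IsLeftCoproper R C)
include hC hcop

lemma toSmash_isIsoOnto : IsIsoOnto (toSmash.{u₁, u₂, u₃, u₄, w} S) (LMod.IsUnital R S.Smash) :=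
  (toOpSmash_isIsoOnto hC hcop).opFunctor_comp_comp_opFunctor

lemma toBoxDualOp_isIsoOnto :
    IsIsoOnto (toBoxDualOp.{u₁, u₂, u₃, u₄, w} S) (LMod.IsUnital R (S.op.boxLeftDual)ᵐᵒᵖ) :=
  (toBoxDual_isIsoOnto hC hcop).opFunctor_comp_comp_opFunctor

end LeftRightOp

end

end DoiKoppinen

theorem mainTheorem12
    {R : Type u₁} {H : Type u₂} {A : Type u₃} {C : Type u₄} [CommRing R]
    [Ring H] [Bialgebra R H] [Ring A] [Algebra R A]
    [AddCommGroup C] [Module R C] [Coalgebra R C]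
    (hC : DoiKoppinen.IsLocallyProjective R C)
    (hcop : DoiKoppinen.IsLeftCoproper R C)
    (hpure : DoiKoppinen.IsBoxPure R C A) :
    (∀ S : DoiKoppinen.RightRight R H A C,
      (∃ h : ∀ M : DoiKoppinen.RRModule.{u₁, u₂, u₃, u₄, w} S,
          DoiKoppinen.RMod.IsUnital R S.OpSmash ((DoiKoppinen.toOpSmash S).obj M),
        DoiKoppinen.IsIsoOfCategories
          ((DoiKoppinen.RMod.IsUnital R S.OpSmash).lift (DoiKoppinen.toOpSmash S) h)) ∧
      (∃ h : ∀ M : DoiKoppinen.RRModule.{u₁, u₂, u₃, u₄, w} S,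
          DoiKoppinen.RMod.IsUnital R S.boxLeftDual ((DoiKoppinen.toBoxDual S).obj M),
        DoiKoppinen.IsIsoOfCategories
          ((DoiKoppinen.RMod.IsUnital R S.boxLeftDual).lift (DoiKoppinen.toBoxDual S) h))) ∧
    (∀ S : DoiKoppinen.LeftRight R H A C,
      (∃ h : ∀ M : DoiKoppinen.LRModule.{u₁, u₂, u₃, u₄, w} S,
          DoiKoppinen.LMod.IsUnital R S.Smash ((DoiKoppinen.toSmash S).obj M),
        DoiKoppinen.IsIsoOfCategories
          ((DoiKoppinen.LMod.IsUnital R S.Smash).lift (DoiKoppinen.toSmash S) h)) ∧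
      (∃ h : ∀ M : DoiKoppinen.LRModule.{u₁, u₂, u₃, u₄, w} S,
          DoiKoppinen.LMod.IsUnital R (S.op.boxLeftDual)ᵐᵒᵖ
            ((DoiKoppinen.toBoxDualOp S).obj M),
        DoiKoppinen.IsIsoOfCategories
          ((DoiKoppinen.LMod.IsUnital R (S.op.boxLeftDual)ᵐᵒᵖ).lift
            (DoiKoppinen.toBoxDualOp S) h))) := by
  exact ⟨fun S => ⟨(DoiKoppinen.toOpSmash_isIsoOnto hC hcop).exists_lift,
      (DoiKoppinen.toBoxDual_isIsoOnto hC hcop).exists_lift⟩,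
    fun S => ⟨(DoiKoppinen.toSmash_isIsoOnto S hC hcop).exists_lift,
      (DoiKoppinen.toBoxDualOp_isIsoOnto S hC hcop).exists_lift⟩⟩
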